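/- **Theorem (Block Decomposition Theorem).** *The operator.* For an exponent matrix $\alpha\in\mathrm{Mat}_{m,n}(\mathbb N)$ let $\mathrm{RSK}(\alpha)=(P,Q)$ be the pair of semistandard tableaux of common shape obtained by reading the columns of $\alpha$ from left to right, each from top to bottom, and inserting, for each position $(i,j)$ met, $\alpha_{i,j}$ times the biletter $(i|j)$: row-insert $i$ into $P$ and record $j$ in the new corner box of $Q$. Let $[P|Q]$ be the product over $c$ of the minors of the generic matrix $Z=[z_{ij}]_{1\le i\le m,1\le j\le n}$ whose row (column) indices are the entries of the $c$-th column of $P$ (of $Q$). Let $\mathsf{RSK}$ be the linear operator on $\mathbb C[z_{ij}]$ with $z^\alpha\mapsto[P|Q]$. Let $\mathsf{RSK}_{m,n,d}$ be its matrix in the basis of monomials of degree $d$, and, for $\sigma\in\mathbb N^m$, $\pi\in\mathbb N^n$ with $|\sigma|=|\pi|$ (where $|\sigma|=\sum_i\sigma_i$), let $\mathsf{RSK}_{\sigma,\pi}$ be its matrix in the basis of monomials $z^\alpha$ such that $\alpha$ has row sums $\sigma$ and column sums $\pi$. *Reduced pairs.* A nonzero reduced pair of degree $d'\geq 1$ is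 a pair $(\sigma,\pi)$ of vectors of positive integers with $|\sigma|=|\pi|=d'$ such that $\sigma_i+\pi_j\le d'$ for all $i,j$, the lengths satisfy $\ell(\sigma)\le\ell(\pi)$, and, if $\ell(\sigma)=\ell(\pi)$, then $\sigma=\pi$ or $\sigma_i>\pi_i$ for the least $i$ with $\sigma_i\ne\pi_i$. For such a pair and $d\ge d'$ let $A_{\sigma,\pi}(d)$ be the number of pairs $(\widetilde\sigma,\widetilde\pi)$ of vectors of positive integers with $|\widetilde\sigma|=|\widetilde\pi|=d$ that are obtained from $(\sigma,\pi)$ by a (possibly empty) sequence of steps $(\tau,\rho)\mapsto(\tau+\vec e_k,\rho+\vec e_l)$, each with $\tau_k+\rho_l\ge|\tau|$. *Claim.* Let $m,n,d\in\mathbb N$ with $d\ge1$. After a simultaneous reordering of rows and columns (in particular, up to similarity), $$\mathsf{RSK}_{m,n,d}=\left(\mathrm{Id}_1^{\oplus N_0(m,n,d)}\right)\oplus\left(\bigoplus_{(\sigma,\pi)}\mathsf{RSK}_{\sigma,\pi}^{\oplus N_{\sigma,\pi}(m,n,d)}\right),$$ where the sum is over all nonzero reduced pairs $(\sigma,\pi)$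 of degree $d'\le d$, $$N_{\sigma,\pi}(m,n,d)=\begin{cases}A_{\sigma,\pi}(d)\left(\binom m{\ell(\sigma)}\binom n{\ell(\pi)}+\binom m{\ell(\pi)}\binom n{\ell(\sigma)}\right)&\text{if }\sigma\ne\pi,\\ A_{\sigma,\pi}(d)\binom m{\ell(\sigma)}\binom n{\ell(\pi)}&\text{if }\sigma=\pi,\end{cases}$$ $$N_0(m,n,d)=\binom{d+n-1}{d}m+\binom{d+m-1}{d}n-mn.$$ Moreover, with $g_{\sigma,\pi}:=|\{(k,l):\sigma_k+\pi_l=d'\}|$, the numbers $A_{\sigma,\pi}(d)$ are given explicitly as follows. If $\ell(\pi)\ge3$, then $A_{\sigma,\pi}(d)=\binom{(d-d')+(g_{\sigma,\pi}-1)}{g_{\sigma,\pi}-1}$ when $g_{\sigma,\pi}\ge1$, and $A_{\sigma,\pi}(d)=\delta_{d,d'}$ when $g_{\sigma,\pi}=0$. If $\ell(\sigma)=\ell(\pi)=2$, then $A_{\sigma,\pi}(d)=4(d-d')+\delta_{d,d'}$. -/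

import Mathlib

namespace BlockRSK

/-! ### The RSK correspondence

A pair `(P, Q)` of tableaux of the same shape with labels in `[m]` and `[n]` is stored as the list
of its rows (top to bottom); each row is the list of its boxes (left to right), and each box is the
pair `(P-label, Q-label)`. -/

/-- A pair `(P, Q)` of fillings of the same shape. -/
abbrev TableauPair (m n : ℕ) : Type := List (List (Fin m × Fin n))

/-- Bumping in one row: if the `P`-labels of the row contain a label larger than `p`, the first
(hence smallest) such label `p'` is replaced by `p`, and the result is `p'` together with the new
row. The `Q`-labels stay in place. The value is `none` if no `P`-label of the row exceeds `p`. -/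
def bump {m n : ℕ} (p : Fin m) :
    List (Fin m × Fin n) → Option (Fin m × List (Fin m × Fin n))
  | [] => none
  | c :: cs =>
    if p < c.1 then some (c.1, (p, c.2) :: cs)
    else (bump p cs).map fun r => (r.1, c :: r.2)

/-- Insertion of the biletter `(p|q)`: row insertion of `p` into `P`, and `q` is put into the new
corner box of `Q`. -/
def insertBiletter {m n : ℕ} (q : Fin n) : TableauPair m n → Fin m → TableauPair m n
  | [], p => [[(p, q)]]
  | row :: rows, p =>
    match bump p row with
    | none => (row ++ [(p, q)]) :: rows
    | some (p', row') => row' :: insertBiletter q rows p'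

/-- The biword of an exponent matrix: the columns are read from left to right, each column from top
to bottom, and the entry in position `(i, j)` contributes that many copies of `(i|j)`. -/
def biword {m n : ℕ} (α : Fin m × Fin n →₀ ℕ) : List (Fin m × Fin n) :=
  (List.finRange n).flatMap fun j =>
    (List.finRange m).flatMap fun i => List.replicate (α (i, j)) (i, j)

/-- The pair `RSK(α) = (P, Q)`. -/
def rsk {m n : ℕ} (α : Fin m × Fin n →₀ ℕ) : TableauPair m n :=
  (biword α).foldl (fun T b => insertBiletter b.2 T b.1) []

/-! ### Bitableaux and the linear operator -/

/-- The `c`-th column (counted from `0`) of a pair of tableaux, read from top to bottom. -/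
def column {m n : ℕ} (T : TableauPair m n) (c : ℕ) : List (Fin m × Fin n) :=
  T.filterMap fun row => row[c]?

/-- The minor of the generic matrix `Z = [z_{ij}]` whose row indices are the first components, and
whose column indices are the second components, of the members of `L`. -/
noncomputable def minor {m n : ℕ} (L : List (Fin m × Fin n)) :
    MvPolynomial (Fin m × Fin n) ℂ :=
  Matrix.det (Matrix.of fun i j : Fin L.length =>
    (MvPolynomial.X ((L.get i).1, (L.get j).2) : MvPolynomial (Fin m × Fin n) ℂ))

/-- The bitableau `[P|Q]`: the product, over all columns, of the minors they index. -/
noncomputable def bitableau {m n : ℕ} (T : TableauPair m n) : MvPolynomial (Fin m × Fin n) ℂ :=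
  ((List.range (T.headD []).length).map fun c => minor (column T c)).prod

/-- The linear operator on `ℂ[z_{ij}]` that sends the monomial `z^α` to the bitableau `[P|Q]`,
where `(P, Q) = RSK(α)`. -/
noncomputable def rskOperator (m n : ℕ) :
    MvPolynomial (Fin m × Fin n) ℂ →ₗ[ℂ] MvPolynomial (Fin m × Fin n) ℂ :=
  (MvPolynomial.basisMonomials (Fin m × Fin n) ℂ).constr ℂ fun α => bitableau (rsk α)

/-- The exponent matrices of the degree-`d` monomials in `ℂ[z_{ij}]`. -/
abbrev Expo (m n d : ℕ) : Type := {α : Fin m × Fin n →₀ ℕ // ∑ x, α x = d}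

/-- The contingency tables with row margins `σ` and column margins `π`. -/
abbrev Cont {m n : ℕ} (σ : Fin m → ℕ) (π : Fin n → ℕ) : Type :=
  {α : Fin m × Fin n →₀ ℕ // (∀ i, ∑ j, α (i, j) = σ i) ∧ ∀ j, ∑ i, α (i, j) = π j}

/-- The matrix of the operator on the degree-`d` part, in the basis of monomials: the entry at
`(β, α)` is the coefficient of `z^β` in the image of `z^α`. -/
noncomputable def rskMatrix (m n d : ℕ) : Matrix (Expo m n d) (Expo m n d) ℂ :=
  Matrix.of fun β α =>
    MvPolynomial.coeff β.1 (rskOperator m n (MvPolynomial.monomial α.1 (1 : ℂ)))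

/-- The matrix of the operator on the weight space of `(σ, π)`, in the basis of monomials. -/
noncomputable def rskWeightMatrix {m n : ℕ} (σ : Fin m → ℕ) (π : Fin n → ℕ) :
    Matrix (Cont σ π) (Cont σ π) ℂ :=
  Matrix.of fun β α =>
    MvPolynomial.coeff β.1 (rskOperator m n (MvPolynomial.monomial α.1 (1 : ℂ)))

/-! ### Weight pairs, reduction, multiplicities -/

/-- The covering relation of the variable-multiplication poset:
`(σ, π) ≺ (σ + e_k, π + e_l)` if `σ_k + π_l ≥ |σ|`. -/
def Covers {r s : ℕ} (x y : (Fin r → ℕ) × (Fin s → ℕ)) : Prop :=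
  ∃ (k : Fin r) (l : Fin s), ∑ i, x.1 i ≤ x.1 k + x.2 l ∧
    y = (x.1 + Pi.single k 1, x.2 + Pi.single l 1)

/-- A nonzero reduced weight pair `(σ, π)`. The first three fields are the standing conventions on
weight pairs: all entries are nonzero, `σ` is not longer than `π`, and if the lengths agree then
`σ` equals `π` or is lexicographically larger. Two vectors of different lengths are never equal,
so a weight vector is given here as a list. -/
structure IsReducedPair (σ π : List ℕ) : Prop where
  entries_ne_zero : (∀ a ∈ σ, a ≠ 0) ∧ ∀ b ∈ π, b ≠ 0
  length_le : σ.length ≤ π.length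
  lex : σ.length = π.length → π ≤ σ
  sum_eq : σ.sum = π.sum
  nonzero : σ.sum ≠ 0
  reduced : ∀ a ∈ σ, ∀ b ∈ π, a + b ≤ σ.sum

/-- The nonzero reduced weight pairs of degree at most `d`. -/
abbrev ReducedPair (d : ℕ) : Type :=
  {x : List ℕ × List ℕ // IsReducedPair x.1 x.2 ∧ x.1.sum ≤ d}

/-- The growth potential: the number of positions `(k, l)` with `σ_k + π_l = |σ|`. -/
def growthPotential (σ π : List ℕ) : ℕ :=
  (Finset.univ.filter fun x : Fin σ.length × Fin π.length =>
    σ.get x.1 + π.get x.2 = σ.sum).card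

/-- The number of degree-`d` weight pairs with nonzero entries whose reduction is the reduced pair
`(σ, π)`, i.e. which lie above `(σ, π)` in the variable-multiplication poset. (The covering relation
preserves lengths, so only pairs of vectors of the lengths of `σ` and `π` have to be considered.) -/
noncomputable def countReducingTo (σ π : List ℕ) (d : ℕ) : ℕ :=
  Set.ncard {x : (Fin σ.length → ℕ) × (Fin π.length → ℕ) |
    (∑ i, x.1 i = d ∧ ∑ j, x.2 j = d) ∧ ((∀ i, x.1 i ≠ 0) ∧ ∀ j, x.2 j ≠ 0) ∧
      Relation.ReflTransGen Covers (σ.get, π.get) x}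

/-- The multiplicity `N_{σ,π}(m, n, d)`. -/
noncomputable def blockMult (m n d : ℕ) (σ π : List ℕ) : ℕ :=
  if σ = π then countReducingTo σ π d * (m.choose σ.length * n.choose π.length)
  else countReducingTo σ π d *
    (m.choose σ.length * n.choose π.length + m.choose π.length * n.choose σ.length)

/-- The multiplicity `N_0(m, n, d)`. For `d ≥ 1` none of the subtractions of natural numbers in
it truncates. -/
def trivialMult (m n d : ℕ) : ℕ :=
  (d + n - 1).choose d * m + (d + m - 1).choose d * n - m * n

end BlockRSK

/-! ### Row insertion of sorted words, organised by piles -/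

namespace BlockRSK

variable {m n : ℕ}

/-! ### Inserting a word into a single row -/

/-! The operator preserves row and column sums, since every tableau pair `RSK(α)` carries the
letters of `α` and each bitableau is homogeneous for the grading by margins
(`bitableau_rsk_homogeneous`). So the matrix splits into one block for each weight, and it remains
to see which blocks agree and how often each occurs. Blocks are unchanged, up to relabelling
monomials, by three operations: inserting zero entries into the weight (`entry_mapDomain`),
exchanging rows and columns (`entry_swap`), and passing to a cover in the variable-multiplication
poset (`entry_add_single`).

The last two rest on a geometric description of RSK. The first box of the first row runs through the
strict left-to-right minima of the biword, its first pile; removing this pile and repeating gives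
the whole row, while the corners between consecutive pile members are the bumped biletters
(`insertRow_cons_row`). For a word in reading order the pile is the set of minimal biletters in the
product order (`mem_minima`). This description is symmetric, so transposing `α` exchanges `P` and
`Q` (`insertWord_swap`). A pile is an antichain, so a chain loses at most one element when a pile is
removed; this bounds the lengths of the lower rows by chains in the bumped word.

Suppose a biletter `z` occurs more often than all biletters outside its row and column. Then
deleting one `z` deletes one box `z` from the first row, changes nothing below it, and this box lies
to the right of all lower rows (`exists_split_firstRow`). Its column is a single box, which
contributes the factor `X z`. The hypothesis on `z` is exactly the covering condition on margins.

Down-steps in the poset satisfy the diamond property (`downStep_diamond`), so each positive balanced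
pair has at most one reduction; with both lengths at least two a reduction exists
(`exists_reduced`). Weights concentrated in one row or one column give unit blocks. Every other
weight, after deletion of its zeros, lies above exactly one reduced pair up to exchange of the two
vectors, and counting these weights gives the multiplicities. For the explicit values: if the second
vector has length at least three, all growth positions lie in one row or column and the pairs above
are counted by weak compositions (`ncard_aboveSet`); for two vectors of length two they are the
boundary points of a square grid (`ncard_aboveSet_two`). -/

/-- The insertion of a word of biletters into one row: the resulting row and the word of the
bumped biletters. -/
def insertRow : List (Fin m × Fin n) → List (Fin m × Fin n) →
    List (Fin m × Fin n) × List (Fin m × Fin n)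
  | r, [] => (r, [])
  | r, b :: w =>
    match bump b.1 r with
    | none => insertRow (r ++ [b]) w
    | some (p, r') => ((insertRow r' w).1, (p, b.2) :: (insertRow r' w).2)

/-- The first row of the pair of tableaux of a word. -/
def firstRow (w : List (Fin m × Fin n)) : List (Fin m × Fin n) := (insertRow [] w).1

/-- The word that is bumped out of the first row. -/
def bumped (w : List (Fin m × Fin n)) : List (Fin m × Fin n) := (insertRow [] w).2

/-- Insertion of a word into a pair of tableaux. -/
def insertWord (T : TableauPair m n) (w : List (Fin m × Fin n)) : TableauPair m n :=
  w.foldl (fun T b => insertBiletter b.2 T b.1) T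

theorem insertWord_cons_row (r : List (Fin m × Fin n)) (T : TableauPair m n)
    (w : List (Fin m × Fin n)) :
    insertWord (r :: T) w = (insertRow r w).1 :: insertWord T (insertRow r w).2 := by
  induction w generalizing r T with
  | nil => rfl
  | cons b w ih =>
    change insertWord (insertBiletter b.2 (r :: T) b.1) w = _
    rw [insertBiletter, insertRow]
    rcases bump b.1 r with _ | ⟨p, r'⟩
    · exact ih _ _
    · exact ih _ _

theorem insertWord_nil_eq {w : List (Fin m × Fin n)} (hw : w ≠ []) :
    insertWord [] w = firstRow w :: insertWord [] (bumped w) := by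
  obtain ⟨b, w, rfl⟩ := List.exists_cons_of_ne_nil hw
  change insertWord [[b]] w = _
  rw [insertWord_cons_row]
  rfl

/-! ### Piles -/

/-- The strict left-to-right minima below `h` of a word, with respect to first components. -/
def pileOn (h : Fin m) : List (Fin m × Fin n) → List (Fin m × Fin n)
  | [] => []
  | b :: w => if b.1 < h then b :: pileOn b.1 w else pileOn h w

/-- The biletters of a word that are not left-to-right minima below `h`. -/
def pileOff (h : Fin m) : List (Fin m × Fin n) → List (Fin m × Fin n)
  | [] => []
  | b :: w => if b.1 < h then pileOff b.1 w else b :: pileOff h w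

/-- The corners between consecutive members of a pile. -/
def corners : List (Fin m × Fin n) → List (Fin m × Fin n)
  | a :: b :: l => (a.1, b.2) :: corners (b :: l)
  | _ => []

theorem corners_cons (a : Fin m × Fin n) (q : Fin n) (l : List (Fin m × Fin n)) :
    corners ((a.1, q) :: l) = corners (a :: l) := by
  cases l <;> rfl

/-- A letter below the current first label replaces it and bumps it out at once; any other letter
goes on to `r` as if the first box were absent. So the first box passes through the pile and keeps
its `Q`-label, and each replacement bumps the old label at the time of the new one, which is a
corner. Corners and later bumps interleave, hence only a permutation is claimed. -/
theorem insertRow_cons_row (c : Fin m × Fin n) (r w : List (Fin m × Fin n)) :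
    (insertRow (c :: r) w).1 =
        (((c :: pileOn c.1 w).getLast (by simp)).1, c.2) :: (insertRow r (pileOff c.1 w)).1 ∧
      ((insertRow (c :: r) w).2).Perm
        (corners (c :: pileOn c.1 w) ++ (insertRow r (pileOff c.1 w)).2) := by
  induction w generalizing c r with
  | nil => simp [insertRow, pileOn, pileOff, corners]
  | cons b w ih =>
    by_cases h : b.1 < c.1
    · have h1 : bump b.1 (c :: r) = some (c.1, (b.1, c.2) :: r) := by simp [bump, h]
      have ih' := ih (b.1, c.2) r
      simp only [insertRow, h1, pileOn, pileOff, h, if_true, corners]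
      refine ⟨?_, ?_⟩
      · rw [ih'.1]
        have key : ∀ l : List (Fin m × Fin n), (((b.1, c.2) :: l).getLast (by simp)).1 =
            ((c :: b :: l).getLast (by simp)).1 := by
          intro l
          cases l <;> simp
        exact congrArg (fun p => (p, c.2) :: _) (key _)
      · rw [List.cons_append]
        refine List.Perm.cons _ (ih'.2.trans ?_)
        rw [corners_cons]
    · simp only [pileOn, pileOff, h, if_false]
      rcases h2 : bump b.1 r with _ | ⟨p, r'⟩
      · have h1 : bump b.1 (c :: r) = none := by simp [bump, h, h2]
        simp only [insertRow, h1, h2, List.cons_append]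
        exact ih c (r ++ [b])
      · have h1 : bump b.1 (c :: r) = some (p, c :: r') := by simp [bump, h, h2]
        simp only [insertRow, h1, h2]
        refine ⟨(ih c r').1, ?_⟩
        exact ((ih c r').2.cons _).trans List.perm_middle.symm

/-- The first pile of a word. -/
def minima : List (Fin m × Fin n) → List (Fin m × Fin n)
  | [] => []
  | b :: w => b :: pileOn b.1 w

/-- The biletters that do not enter the first pile. -/
def remainder : List (Fin m × Fin n) → List (Fin m × Fin n)
  | [] => []
  | b :: w => pileOff b.1 w

/-- The box of the first row that belongs to a pile. -/
def cell (l : List (Fin m × Fin n)) (h : l ≠ []) : Fin m × Fin n :=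
  ((l.getLast h).1, (l.head h).2)

theorem minima_ne_nil {w : List (Fin m × Fin n)} (h : w ≠ []) : minima w ≠ [] := by
  cases w <;> simp_all [minima]

theorem firstRow_eq {w : List (Fin m × Fin n)} (h : w ≠ []) :
    firstRow w = cell (minima w) (minima_ne_nil h) :: firstRow (remainder w) := by
  obtain ⟨b, w, rfl⟩ := List.exists_cons_of_ne_nil h
  exact (insertRow_cons_row b [] w).1

theorem bumped_perm (w : List (Fin m × Fin n)) :
    (bumped w).Perm (corners (minima w) ++ bumped (remainder w)) := by
  cases w with
  | nil => simp [bumped, minima, remainder, corners, insertRow]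
  | cons b w => exact (insertRow_cons_row b [] w).2

theorem firstRow_nil : firstRow ([] : List (Fin m × Fin n)) = [] := rfl

theorem bumped_nil : bumped ([] : List (Fin m × Fin n)) = [] := rfl

theorem pileOn_append_pileOff (h : Fin m) (w : List (Fin m × Fin n)) :
    (pileOn h w ++ pileOff h w).Perm w := by
  induction w generalizing h with
  | nil => simp [pileOn, pileOff]
  | cons b w ih =>
    by_cases hb : b.1 < h
    · simpa [pileOn, pileOff, hb] using ih b.1
    · simp only [pileOn, pileOff, hb, if_false]
      exact List.perm_middle.trans ((ih h).cons _)

theorem minima_append_remainder (w : List (Fin m × Fin n)) :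
    (minima w ++ remainder w).Perm w := by
  cases w with
  | nil => simp [minima, remainder]
  | cons b w => exact (pileOn_append_pileOff b.1 w).cons b

theorem pileOff_sublist (h : Fin m) (w : List (Fin m × Fin n)) : (pileOff h w).Sublist w := by
  induction w generalizing h with
  | nil => simp [pileOff]
  | cons b w ih =>
    by_cases hb : b.1 < h
    · simpa [pileOff, hb] using (ih b.1).cons b
    · simpa [pileOff, hb] using ih h

theorem remainder_sublist (w : List (Fin m × Fin n)) : (remainder w).Sublist w := by
  cases w with
  | nil => simp [remainder]
  | cons b w => exact (pileOff_sublist b.1 w).cons b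

theorem length_remainder_lt {w : List (Fin m × Fin n)} (h : w ≠ []) :
    (remainder w).length < w.length := by
  obtain ⟨b, w, rfl⟩ := List.exists_cons_of_ne_nil h
  exact Nat.lt_succ_of_le (pileOff_sublist b.1 w).length_le

theorem length_bumped_le (w : List (Fin m × Fin n)) (r : List (Fin m × Fin n)) :
    (insertRow r w).2.length ≤ w.length := by
  induction w generalizing r with
  | nil => simp [insertRow]
  | cons b w ih =>
    rw [insertRow]
    rcases bump b.1 r with _ | ⟨p, r'⟩
    · exact (ih _).trans (by simp)
    · simpa using ih _

theorem length_bumped_lt {w : List (Fin m × Fin n)} (h : w ≠ []) :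
    (bumped w).length < w.length := by
  obtain ⟨b, w, rfl⟩ := List.exists_cons_of_ne_nil h
  exact Nat.lt_succ_of_le (length_bumped_le w [b])

/-! ### Sorted words -/

/-- The order in which the biletters of an exponent matrix are read. -/
def ReadLE (a b : Fin m × Fin n) : Prop := a.2 < b.2 ∨ a.2 = b.2 ∧ a.1 ≤ b.1

/-- The words that are in reading order. -/
abbrev IsSorted (w : List (Fin m × Fin n)) : Prop := w.Pairwise ReadLE

instance : Std.Antisymm (ReadLE (m := m) (n := n)) where
  antisymm a b h h' := by
    rcases a with ⟨a, a'⟩; rcases b with ⟨b, b'⟩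
    simp only [ReadLE, Prod.mk.injEq] at *
    omega

theorem IsSorted.eq_of_perm {v w : List (Fin m × Fin n)} (hv : IsSorted v) (hw : IsSorted w)
    (h : v.Perm w) : v = w :=
  h.eq_of_pairwise' hv hw

theorem IsSorted.remainder {w : List (Fin m × Fin n)} (h : IsSorted w) :
    IsSorted (remainder w) :=
  List.Pairwise.sublist (remainder_sublist w) h

theorem bump_eq_some {p p' : Fin m} {r r' : List (Fin m × Fin n)}
    (h : bump p r = some (p', r')) :
    p < p' ∧ (∃ e ∈ r, e.1 = p') ∧ (∀ e ∈ r', e.1 = p ∨ ∃ f ∈ r, f.1 = e.1) ∧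
      (r.Pairwise (fun a b => a.1 ≤ b.1) → (∀ e ∈ r, p < e.1 → p' ≤ e.1) ∧
        r'.Pairwise (fun a b => a.1 ≤ b.1)) := by
  induction r generalizing r' with
  | nil => simp [bump] at h
  | cons c r ih =>
    by_cases hc : p < c.1
    · simp only [bump, hc, if_true, Option.some.injEq, Prod.mk.injEq] at h
      obtain ⟨rfl, rfl⟩ := h
      refine ⟨hc, ⟨c, by simp⟩, ?_, ?_⟩
      · intro e he
        rcases List.mem_cons.1 he with rfl | he
        · exact Or.inl rfl
        · exact Or.inr ⟨e, by simp [he], rfl⟩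
      · intro hr
        rw [List.pairwise_cons] at hr
        refine ⟨?_, List.pairwise_cons.2 ⟨fun e he => hc.le.trans (hr.1 e he), hr.2⟩⟩
        intro e he _
        rcases List.mem_cons.1 he with rfl | he
        · exact le_rfl
        · exact hr.1 e he
    · simp only [bump, hc, if_false, Option.map_eq_some_iff, Prod.mk.injEq, Prod.exists] at h
      obtain ⟨a, s, hs, rfl, rfl⟩ := h
      obtain ⟨h1, ⟨e, he, he'⟩, h3, h4⟩ := ih hs
      refine ⟨h1, ⟨e, by simp [he], he'⟩, ?_, ?_⟩
      · intro e he
        rcases List.mem_cons.1 he with rfl | he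
        · exact Or.inr ⟨e, by simp⟩
        · rcases h3 e he with h | ⟨f, hf, hf'⟩
          · exact Or.inl h
          · exact Or.inr ⟨f, by simp [hf], hf'⟩
      · intro hr
        rw [List.pairwise_cons] at hr
        obtain ⟨h5, h6⟩ := h4 hr.2
        refine ⟨?_, List.pairwise_cons.2 ⟨fun e he => ?_, h6⟩⟩
        · intro e he hpe
          rcases List.mem_cons.1 he with rfl | he
          · exact absurd hpe hc
          · exact h5 e he hpe
        · rcases h3 e he with h | ⟨f, hf, hf'⟩
          · rw [h]; exact not_lt.1 hc
          · rw [← hf']; exact hr.1 f hf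

theorem bump_eq_none {p : Fin m} {r : List (Fin m × Fin n)} (h : bump p r = none) :
    ∀ e ∈ r, e.1 ≤ p := by
  induction r with
  | nil => simp
  | cons c r ih =>
    by_cases hc : p < c.1
    · simp [bump, hc] at h
    · simp only [bump, hc, if_false, Option.map_eq_none_iff] at h
      intro e he
      rcases List.mem_cons.1 he with rfl | he
      · exact not_lt.1 hc
      · exact ih h e he

/-- Here `z` is a bumped biletter and `p` the label inserted last. Later bumps from a later column
exceed `z` in the second component. In the same column the inserted labels are at least `p`, so they
bump labels greater than `p`, which by the invariant `hr` are at least `z.1`. -/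
theorem readLE_insertRow {z : Fin m × Fin n} {p : Fin m} {r w : List (Fin m × Fin n)}
    (hr : ∀ e ∈ r, p < e.1 → z.1 ≤ e.1) (hw : IsSorted ((p, z.2) :: w)) :
    ∀ x ∈ (insertRow r w).2, ReadLE z x := by
  induction w generalizing p r with
  | nil => simp [insertRow]
  | cons b w ih =>
    rw [IsSorted, List.pairwise_cons, List.pairwise_cons] at hw
    obtain ⟨h1, h2, h3⟩ := hw
    have hbz : ReadLE (p, z.2) b := h1 b (by simp)
    rcases hbz with hlt | ⟨heq, hle⟩
    · intro x hx
      -- Bumping changes only first components, so second components of bumped biletters come from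
      -- the inserted word.
      have key : ∀ (r w : List (Fin m × Fin n)), (∀ y ∈ w, z.2 < y.2) →
          ∀ x ∈ (insertRow r w).2, z.2 < x.2 := by
        clear hx x ih
        intro r w
        induction w generalizing r with
        | nil => simp [insertRow]
        | cons b w ih =>
          intro hb x hx
          rw [insertRow] at hx
          rcases h : bump b.1 r with _ | ⟨p, r'⟩
          · rw [h] at hx
            exact ih _ (fun y hy => hb y (by simp [hy])) x hx
          · rw [h] at hx
            rcases List.mem_cons.1 hx with rfl | hx
            · exact hb b (by simp)
            · exact ih _ (fun y hy => hb y (by simp [hy])) x hx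
      refine Or.inl (key r (b :: w) ?_ x hx)
      intro y hy
      rcases List.mem_cons.1 hy with rfl | hy
      · exact hlt
      · rcases h2 y hy with h | h
        · exact lt_trans hlt h
        · exact h.1 ▸ hlt
    · have hb : IsSorted ((b.1, z.2) :: w) := by
        refine List.pairwise_cons.2 ⟨fun y hy => ?_, h3⟩
        have := h2 y hy
        rwa [ReadLE, ← heq] at this
      intro x hx
      rw [insertRow] at hx
      rcases h : bump b.1 r with _ | ⟨p', r'⟩
      · rw [h] at hx
        refine ih (p := b.1) (fun e he hbe => ?_) hb x hx
        rcases List.mem_append.1 he with he | he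
        · exact hr e he (lt_of_le_of_lt hle hbe)
        · simp only [List.mem_singleton] at he
          exact absurd hbe (by simp [he])
      · rw [h] at hx
        obtain ⟨g1, ⟨e, he, he'⟩, g3, -⟩ := bump_eq_some h
        rcases List.mem_cons.1 hx with rfl | hx
        · exact Or.inr ⟨heq, he' ▸ hr e he (he' ▸ lt_of_le_of_lt hle g1)⟩
        · refine ih (p := b.1) (fun e he hbe => ?_) hb x hx
          rcases g3 e he with h | ⟨f, hf, hf'⟩
          · exact absurd hbe (by simp [h])
          · exact hf' ▸ hr f hf (hf' ▸ lt_of_le_of_lt hle hbe)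

/-- In an increasing row the bumped label is the smallest one above the inserted label, which is the
invariant that `readLE_insertRow` starts from. Sortedness lets the recursion continue with the next
row and turns permutations of bumped words into equalities. -/
theorem isSorted_insertRow {r w : List (Fin m × Fin n)} (hr : r.Pairwise (fun a b => a.1 ≤ b.1))
    (hw : IsSorted w) : IsSorted (insertRow r w).2 := by
  induction w generalizing r with
  | nil => simp [insertRow]
  | cons b w ih =>
    rw [insertRow]
    rcases h : bump b.1 r with _ | ⟨p, r'⟩
    · refine ih ?_ hw.of_cons
      refine List.pairwise_append.2 ⟨hr, by simp, fun a ha c hc => ?_⟩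
      simp only [List.mem_singleton] at hc
      exact hc ▸ bump_eq_none h a ha
    · obtain ⟨g1, -, g3, g4⟩ := bump_eq_some h
      refine List.pairwise_cons.2 ⟨?_, ih (g4 hr).2 hw.of_cons⟩
      refine readLE_insertRow (z := (p, b.2)) (p := b.1) (fun e he hbe => ?_) hw
      rcases g3 e he with h | ⟨f, hf, hf'⟩
      · exact absurd hbe (by simp [h])
      · exact hf' ▸ (g4 hr).1 f hf (hf' ▸ hbe)

theorem IsSorted.bumped {w : List (Fin m × Fin n)} (h : IsSorted w) : IsSorted (bumped w) :=
  isSorted_insertRow (by simp) h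

/-! ### Minimal biletters -/

/-- Piles: first components decrease, second components increase. -/
abbrev IsPile (l : List (Fin m × Fin n)) : Prop :=
  l.Pairwise fun a b => b.1 < a.1 ∧ a.2 < b.2

theorem mem_pileOn_lt {h : Fin m} {w : List (Fin m × Fin n)} {x : Fin m × Fin n}
    (hx : x ∈ pileOn h w) : x.1 < h := by
  induction w generalizing h with
  | nil => simp [pileOn] at hx
  | cons b w ih =>
    by_cases hb : b.1 < h
    · simp only [pileOn, hb, if_true, List.mem_cons] at hx
      rcases hx with rfl | hx
      · exact hb
      · exact (ih hx).trans hb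
    · simp only [pileOn, hb, if_false] at hx
      exact ih hx

theorem pileOn_sublist (h : Fin m) (w : List (Fin m × Fin n)) : (pileOn h w).Sublist w := by
  induction w generalizing h with
  | nil => simp [pileOn]
  | cons b w ih =>
    by_cases hb : b.1 < h
    · simpa [pileOn, hb] using ih b.1
    · simpa [pileOn, hb] using (ih h).cons b

/-- Within one column labels are read in weakly increasing order, so a strict descent of the first
component forces a later column. -/
theorem isPile_minima {w : List (Fin m × Fin n)} (hw : IsSorted w) : IsPile (minima w) := by
  have key : ∀ (b : Fin m × Fin n) (w : List (Fin m × Fin n)), IsSorted (b :: w) →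
      IsPile (b :: pileOn b.1 w) := by
    intro b w
    induction w generalizing b with
    | nil => simp [pileOn]
    | cons c w ih =>
      intro hw
      by_cases hc : c.1 < b.1
      · simp only [pileOn, hc, if_true]
        refine List.pairwise_cons.2 ⟨fun x hx => ?_, ih c hw.of_cons⟩
        have hxb : x.1 < b.1 := by
          rcases List.mem_cons.1 hx with rfl | hx
          · exact hc
          · exact (mem_pileOn_lt hx).trans hc
        have hxw : x ∈ c :: w := by
          rcases List.mem_cons.1 hx with rfl | hx
          · simp
          · exact List.mem_cons_of_mem _ ((pileOn_sublist _ _).subset hx)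
        refine ⟨hxb, ?_⟩
        rcases (List.pairwise_cons.1 hw).1 x hxw with h | h
        · exact h
        · exact absurd h.2 (not_le.2 hxb)
      · simp only [pileOn, hc, if_false]
        exact ih b (List.Pairwise.sublist (by simp) hw)
  cases w with
  | nil => simp [minima]
  | cons b w => exact key b w hw

/-- Every biletter of a sorted word lies weakly above a member of the first pile. -/
theorem exists_minima_le {w : List (Fin m × Fin n)} (hw : IsSorted w) {x : Fin m × Fin n}
    (hx : x ∈ w) : ∃ y ∈ minima w, y ≤ x := by
  have key : ∀ (b : Fin m × Fin n) (w : List (Fin m × Fin n)), IsSorted (b :: w) →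
      ∀ x ∈ b :: w, ∃ y ∈ b :: pileOn b.1 w, y ≤ x := by
    intro b w
    induction w generalizing b with
    | nil => intro _ x hx; exact ⟨x, by simpa [pileOn] using hx, le_rfl⟩
    | cons c w ih =>
      intro hw x hx
      have hle2 : ∀ x ∈ c :: w, b.2 ≤ x.2 := fun x hx => by
        rcases (List.pairwise_cons.1 hw).1 x hx with h | h
        · exact h.le
        · exact h.1.le
      by_cases hc : c.1 < b.1
      · simp only [pileOn, hc, if_true]
        rcases List.mem_cons.1 hx with rfl | hx
        · exact ⟨x, by simp, le_rfl⟩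
        · obtain ⟨y, hy, hyx⟩ := ih c hw.of_cons x hx
          exact ⟨y, List.mem_cons_of_mem _ hy, hyx⟩
      · simp only [pileOn, hc, if_false]
        rcases List.mem_cons.1 hx with rfl | hx
        · exact ⟨x, by simp, le_rfl⟩
        · rcases List.mem_cons.1 hx with rfl | hx'
          · exact ⟨b, by simp, not_lt.1 hc, hle2 x hx⟩
          · exact ih b (List.Pairwise.sublist (by simp) hw) x (List.mem_cons_of_mem _ hx')
  cases w with
  | nil => simp at hx
  | cons b w => exact key b w hw x hx

theorem mem_of_mem_minima {w : List (Fin m × Fin n)} {x : Fin m × Fin n} (h : x ∈ minima w) :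
    x ∈ w :=
  (minima_append_remainder w).subset (List.mem_append_left _ h)

theorem IsPile.eq_of_le {l : List (Fin m × Fin n)} (hl : IsPile l) {x y : Fin m × Fin n}
    (hx : x ∈ l) (hy : y ∈ l) (h : x ≤ y) : x = y := by
  by_contra hne
  have : Std.Symm fun a b : Fin m × Fin n =>
      b.1 < a.1 ∧ a.2 < b.2 ∨ a.1 < b.1 ∧ b.2 < a.2 := ⟨fun _ _ h => h.symm⟩
  have : (fun a b : Fin m × Fin n => b.1 < a.1 ∧ a.2 < b.2 ∨ a.1 < b.1 ∧ b.2 < a.2) x y :=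
    List.Pairwise.forall (R := fun a b : Fin m × Fin n =>
        b.1 < a.1 ∧ a.2 < b.2 ∨ a.1 < b.1 ∧ b.2 < a.2)
      (hl.imp fun h => Or.inl h) hx hy hne
  rcases this with h' | h'
  · exact absurd h.1 (not_le.2 h'.1)
  · exact absurd h.2 (not_le.2 h'.2)

/-- This removes the reading order from the description of the pile: minimality in the product order
treats both components alike. -/
theorem mem_minima {w : List (Fin m × Fin n)} (hw : IsSorted w) {x : Fin m × Fin n} :
    x ∈ minima w ↔ x ∈ w ∧ ∀ y ∈ w, y ≤ x → y = x := by
  constructor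
  · intro hx
    refine ⟨mem_of_mem_minima hx, fun y hy hyx => ?_⟩
    obtain ⟨z, hz, hzy⟩ := exists_minima_le hw hy
    have := (isPile_minima hw).eq_of_le hz hx (hzy.trans hyx)
    subst this
    exact le_antisymm hyx hzy
  · rintro ⟨hx, h⟩
    obtain ⟨y, hy, hyx⟩ := exists_minima_le hw hx
    exact h y (mem_of_mem_minima hy) hyx ▸ hy

theorem IsPile.nodup {l : List (Fin m × Fin n)} (hl : IsPile l) : l.Nodup :=
  hl.imp fun h he => absurd h.1 (by simp [he])

theorem IsPile.ext {l l' : List (Fin m × Fin n)} (hl : IsPile l) (hl' : IsPile l')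
    (h : ∀ x, x ∈ l ↔ x ∈ l') : l = l' := by
  have hp := (List.perm_ext_iff_of_nodup hl.nodup hl'.nodup).2 h
  refine hp.eq_of_pairwise (le := fun a b => b.1 < a.1 ∧ a.2 < b.2) ?_ hl hl'
  intro a b _ _ h h'
  exact absurd h.1 (not_lt.2 h'.1.le)

end BlockRSK

/-! ### Symmetry of RSK, chains and row lengths, deletion of a dominant biletter -/

namespace BlockRSK

variable {m n : ℕ}

/-! ### Symmetry -/

theorem corners_concat (l : List (Fin m × Fin n)) (a b : Fin m × Fin n) :
    corners (l ++ [a, b]) = corners (l ++ [a]) ++ [(a.1, b.2)] := by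
  induction l with
  | nil => rfl
  | cons c l ih =>
    cases l with
    | nil => rfl
    | cons d l => simpa [corners] using ih

theorem corners_reverse_swap (l : List (Fin m × Fin n)) :
    corners (l.reverse.map Prod.swap) = ((corners l).map Prod.swap).reverse := by
  induction l with
  | nil => rfl
  | cons a l ih =>
    cases l with
    | nil => rfl
    | cons b l =>
      have : (a :: b :: l).reverse.map Prod.swap =
          l.reverse.map Prod.swap ++ [b.swap, a.swap] := by simp
      rw [this, corners_concat]
      have h2 : l.reverse.map Prod.swap ++ [b.swap] = (b :: l).reverse.map Prod.swap := by simp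
      rw [h2, ih]
      simp [corners]

/-- Swapping preserves minimality, and it reverses the pile because one component decreases where
the other increases. -/
theorem minima_swap {w : List (Fin m × Fin n)} {v' : List (Fin n × Fin m)} (hw : IsSorted w)
    (hv : IsSorted v') (h : v'.Perm (w.map Prod.swap)) :
    minima v' = (minima w).reverse.map Prod.swap := by
  refine (isPile_minima hv).ext ?_ fun x => ?_
  · rw [IsPile, List.pairwise_map, List.pairwise_reverse]
    exact (isPile_minima hw).imp fun h => ⟨h.2, h.1⟩
  · have hmem : ∀ y, y ∈ v' ↔ y.swap ∈ w := fun y => by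
      rw [h.mem_iff, List.mem_map]
      constructor
      · rintro ⟨z, hz, rfl⟩; simpa using hz
      · intro hy; exact ⟨_, hy, by simp⟩
    have hm : x ∈ (minima w).reverse.map Prod.swap ↔ x.swap ∈ minima w := by
      rw [List.mem_map]
      constructor
      · rintro ⟨z, hz, rfl⟩; simpa using hz
      · intro hy; exact ⟨x.swap, by simpa using hy, by simp⟩
    rw [hm, mem_minima hv, mem_minima hw, hmem]
    refine and_congr_right fun _ => ⟨fun H y hy hyx => ?_, fun H y hy hyx => ?_⟩
    · have := H y.swap ((hmem _).2 (by simpa using hy)) ⟨hyx.2, hyx.1⟩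
      rw [← this]; simp
    · have := H y.swap ((hmem _).1 hy) ⟨hyx.2, hyx.1⟩
      exact Prod.swap_injective this

/-- Induction over piles: reversing and swapping a pile exchanges the two coordinates of its cell
and of each of its corners. -/
theorem firstRow_bumped_swap {w : List (Fin m × Fin n)} {v : List (Fin n × Fin m)}
    (hw : IsSorted w) (hv : IsSorted v) (h : v.Perm (w.map Prod.swap)) :
    firstRow v = (firstRow w).map Prod.swap ∧ (bumped v).Perm ((bumped w).map Prod.swap) := by
  induction hN : w.length using Nat.strong_induction_on generalizing w v with
  | _ N ih =>
  by_cases hw0 : w = []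
  · subst hw0
    have : v = [] := by simpa using h
    subst this
    simp [firstRow_nil, bumped_nil]
  · have hv0 : v ≠ [] := by
      rintro rfl
      exact hw0 (by simpa using h)
    have hm := minima_swap hw hv h
    have hr : (remainder v).Perm ((remainder w).map Prod.swap) := by
      have h1 : (minima v ++ remainder v).Perm
          ((minima w).map Prod.swap ++ (remainder w).map Prod.swap) := by
        rw [← List.map_append]
        exact (minima_append_remainder v).trans
          (h.trans ((minima_append_remainder w).map _).symm)
      have h2 : ((minima w).map Prod.swap ++ remainder v).Perm (minima v ++ remainder v) := by
        refine List.Perm.append_right _ ?_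
        rw [hm]
        exact (List.reverse_perm _).symm.map _
      exact (List.perm_append_left_iff _).1 (h2.trans h1)
    obtain ⟨ih1, ih2⟩ := ih _ (hN ▸ length_remainder_lt hw0) hw.remainder hv.remainder hr rfl
    constructor
    · rw [firstRow_eq hw0, firstRow_eq hv0, ih1, List.map_cons]
      congr 1
      simp [cell, hm]
    · refine (bumped_perm v).trans (List.Perm.trans ?_ ((bumped_perm w).map _).symm)
      rw [List.map_append, hm, corners_reverse_swap]
      exact (List.reverse_perm _).append ih2

theorem insertWord_swap {w : List (Fin m × Fin n)} {v : List (Fin n × Fin m)}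
    (hw : IsSorted w) (hv : IsSorted v) (h : v.Perm (w.map Prod.swap)) :
    insertWord [] v = (insertWord [] w).map (List.map Prod.swap) := by
  induction hN : w.length using Nat.strong_induction_on generalizing w v with
  | _ N ih =>
  by_cases hw0 : w = []
  · subst hw0
    have : v = [] := by simpa using h
    subst this
    rfl
  · have hv0 : v ≠ [] := by
      rintro rfl
      exact hw0 (by simpa using h)
    obtain ⟨h1, h2⟩ := firstRow_bumped_swap hw hv h
    rw [insertWord_nil_eq hw0, insertWord_nil_eq hv0, h1,
      ih _ (hN ▸ length_bumped_lt hw0) hw.bumped hv.bumped h2 rfl]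
    rfl

/-! ### Chains -/

/-- Multisets of pairwise comparable biletters. -/
def IsChainMultiset (s : Multiset (Fin m × Fin n)) : Prop := ∀ x ∈ s, ∀ y ∈ s, x ≤ y ∨ y ≤ x

theorem IsPile.corners_aux {b : Fin m × Fin n} {l : List (Fin m × Fin n)} (h : IsPile (b :: l)) :
    IsPile (corners (b :: l)) ∧ ∀ x ∈ corners (b :: l), x.1 ≤ b.1 ∧ b.2 < x.2 := by
  induction l generalizing b with
  | nil => simp [corners]
  | cons c l ih =>
    obtain ⟨h1, h2⟩ := ih h.of_cons
    have hbc := (List.pairwise_cons.1 h).1 c (by simp)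
    refine ⟨List.pairwise_cons.2 ⟨fun x hx => ⟨(h2 x hx).1.trans_lt hbc.1, (h2 x hx).2⟩, h1⟩, ?_⟩
    intro x hx
    rcases List.mem_cons.1 hx with rfl | hx
    · exact ⟨le_rfl, hbc.2⟩
    · exact ⟨(h2 x hx).1.trans hbc.1.le, hbc.2.trans (h2 x hx).2⟩

theorem IsPile.corners {l : List (Fin m × Fin n)} (h : IsPile l) : IsPile (corners l) := by
  cases l with
  | nil => simp [BlockRSK.corners]
  | cons b l => exact h.corners_aux.1

/-- A pile is an antichain without repetitions, so it meets a chain in at most one element, even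
with multiplicity; subtract it. -/
theorem IsChainMultiset.exists_le_of_pile {l : List (Fin m × Fin n)} (hl : IsPile l)
    {s t : Multiset (Fin m × Fin n)} (hs : IsChainMultiset s) (h : s ≤ (l : Multiset (Fin m × Fin n)) + t) :
    ∃ s' ≤ t, IsChainMultiset s' ∧ s.card ≤ s'.card + 1 := by
  refine ⟨s - l, Multiset.sub_le_iff_le_add'.2 h, fun x hx y hy =>
    hs x (Multiset.mem_of_le (Multiset.sub_le_self _ _) hx)
      y (Multiset.mem_of_le (Multiset.sub_le_self _ _) hy), ?_⟩
  rw [← Multiset.sub_add_inter s (l : Multiset (Fin m × Fin n)), Multiset.card_add]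
  simp only [Multiset.sub_add_inter]
  refine Nat.add_le_add_left ?_ _
  by_contra hc
  obtain ⟨x, hx⟩ := Multiset.card_pos_iff_exists_mem.1 (lt_trans Nat.zero_lt_one (not_le.1 hc))
  obtain ⟨t', ht'⟩ := Multiset.exists_cons_of_mem hx
  have ht0 : 0 < t'.card := by
    rw [ht', Multiset.card_cons] at hc
    omega
  obtain ⟨y, hy⟩ := Multiset.card_pos_iff_exists_mem.1 ht0
  have hnd : (s ∩ (l : Multiset (Fin m × Fin n))).Nodup :=
    Multiset.nodup_of_le Multiset.inter_le_right (Multiset.coe_nodup.2 hl.nodup)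
  rw [ht', Multiset.nodup_cons] at hnd
  have hx1 := Multiset.mem_inter.1 (ht' ▸ Multiset.mem_cons_self x t' : x ∈ s ∩ (l : Multiset (Fin m × Fin n)))
  have hy1 := Multiset.mem_inter.1
    (ht' ▸ Multiset.mem_cons_of_mem hy : y ∈ s ∩ (l : Multiset (Fin m × Fin n)))
  have : x = y := by
    rcases hs x hx1.1 y hy1.1 with h | h
    · exact hl.eq_of_le hx1.2 hy1.2 h
    · exact (hl.eq_of_le hy1.2 hx1.2 h).symm
  exact hnd.1 (this ▸ hy)

/-- The row has one box per pile. A chain taken from the later piles extends downwards, since its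
least element lies above some member of the first pile. -/
theorem exists_chain_firstRow {w : List (Fin m × Fin n)} (hw : IsSorted w) :
    ∃ l : List (Fin m × Fin n), l.Pairwise (· ≤ ·) ∧ (l : Multiset (Fin m × Fin n)) ≤ (w : Multiset (Fin m × Fin n)) ∧
      l.length = (firstRow w).length := by
  induction hN : w.length using Nat.strong_induction_on generalizing w with
  | _ N ih =>
  by_cases hw0 : w = []
  · subst hw0
    exact ⟨[], by simp [firstRow_nil]⟩
  · obtain ⟨l, h1, h2, h3⟩ := ih _ (hN ▸ length_remainder_lt hw0) hw.remainder rfl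
    obtain ⟨y, hy, hyl⟩ : ∃ y ∈ minima w, ∀ x ∈ l, y ≤ x := by
      cases l with
      | nil =>
        obtain ⟨y, hy⟩ := List.exists_mem_of_ne_nil _ (minima_ne_nil hw0)
        exact ⟨y, hy, by simp⟩
      | cons x l =>
        have hx : x ∈ remainder w := Multiset.mem_of_le h2 (by simp)
        obtain ⟨y, hy, hyx⟩ := exists_minima_le hw ((remainder_sublist w).subset hx)
        refine ⟨y, hy, fun z hz => ?_⟩
        rcases List.mem_cons.1 hz with rfl | hz
        · exact hyx
        · exact hyx.trans ((List.pairwise_cons.1 h1).1 z hz)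
    refine ⟨y :: l, List.pairwise_cons.2 ⟨hyl, h1⟩, ?_, ?_⟩
    · rw [← Multiset.coe_eq_coe.2 (minima_append_remainder w), ← Multiset.coe_add,
        ← Multiset.cons_coe, ← Multiset.singleton_add]
      exact add_le_add (Multiset.singleton_le.2 hy) h2
    · rw [firstRow_eq hw0, List.length_cons, List.length_cons, h3]

/-- The corners of each pile form a pile again, so each of the piles, one per box of the first row,
contributes at most one element to a chain of bumped biletters. -/
theorem card_chain_bumped_le {w : List (Fin m × Fin n)} (hw : IsSorted w)
    {s : Multiset (Fin m × Fin n)} (hs : IsChainMultiset s) (h : s ≤ (bumped w : Multiset (Fin m × Fin n))) :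
    s.card ≤ (firstRow w).length := by
  induction hN : w.length using Nat.strong_induction_on generalizing w s with
  | _ N ih =>
  by_cases hw0 : w = []
  · subst hw0
    have : s = 0 := by simpa [bumped_nil] using h
    simp [this]
  · rw [Multiset.coe_eq_coe.2 (bumped_perm w), ← Multiset.coe_add] at h
    obtain ⟨s', h1, h2, h3⟩ := hs.exists_le_of_pile (isPile_minima hw).corners h
    have := ih _ (hN ▸ length_remainder_lt hw0) hw.remainder h2 h1 rfl
    rw [firstRow_eq hw0, List.length_cons]
    omega

/-- A bound for all chains in the bumped word bounds the length of the second row. -/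
theorem length_firstRow_bumped_le {w : List (Fin m × Fin n)} (hw : IsSorted w) {N : ℕ}
    (h : ∀ s ≤ (bumped w : Multiset (Fin m × Fin n)), IsChainMultiset s → s.card ≤ N) :
    (firstRow (bumped w)).length ≤ N := by
  obtain ⟨l, h1, h2, h3⟩ := exists_chain_firstRow hw.bumped
  rw [← h3]
  refine h l h2 fun x hx y hy => ?_
  by_cases hxy : x = y
  · exact Or.inl hxy.le
  · have : Std.Symm fun a b : Fin m × Fin n => a ≤ b ∨ b ≤ a := ⟨fun _ _ h => h.symm⟩
    exact List.Pairwise.forall (R := fun a b : Fin m × Fin n => a ≤ b ∨ b ≤ a)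
      (h1.imp fun h => Or.inl h) hx hy hxy

theorem length_le_of_mem_insertWord {w : List (Fin m × Fin n)} (hw : IsSorted w)
    {r : List (Fin m × Fin n)} (hr : r ∈ insertWord [] w) : r.length ≤ (firstRow w).length := by
  induction hN : w.length using Nat.strong_induction_on generalizing w with
  | _ N ih =>
  by_cases hw0 : w = []
  · subst hw0
    simp [insertWord] at hr
  · rw [insertWord_nil_eq hw0] at hr
    rcases List.mem_cons.1 hr with rfl | hr
    · exact le_rfl
    · exact (ih _ (hN ▸ length_bumped_lt hw0) hw.bumped hr rfl).trans
        (length_firstRow_bumped_le hw fun s h1 h2 => card_chain_bumped_le hw h2 h1)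

/-! ### Insertion of a dominant biletter -/

/-- The number of biletters that share no component with `z`. -/
def outside (z : Fin m × Fin n) (w : List (Fin m × Fin n)) : ℕ :=
  w.countP fun x => decide (x.1 ≠ z.1 ∧ x.2 ≠ z.2)

theorem outside_eq (z : Fin m × Fin n) (w : List (Fin m × Fin n)) :
    outside z w = outside z (minima w) + outside z (remainder w) := by
  rw [outside, ← (minima_append_remainder w).countP_eq, List.countP_append]
  rfl

theorem count_eq (z : Fin m × Fin n) (w : List (Fin m × Fin n)) :
    w.count z = (minima w).count z + (remainder w).count z := by
  rw [← (minima_append_remainder w).count_eq, List.count_append]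

theorem outside_pos {z x : Fin m × Fin n} {w : List (Fin m × Fin n)} (hx : x ∈ w)
    (h1 : x.1 ≠ z.1) (h2 : x.2 ≠ z.2) : 0 < outside z w :=
  List.countP_pos_iff.2 ⟨x, hx, by simp [h1, h2]⟩

theorem cell_mem {l : List (Fin m × Fin n)} (h : l ≠ []) :
    (∃ x ∈ l, x.1 = (cell l h).1) ∧ ∃ x ∈ l, x.2 = (cell l h).2 :=
  ⟨⟨_, List.getLast_mem h, rfl⟩, ⟨_, List.head_mem h, rfl⟩⟩

theorem IsPile.cell_le {l : List (Fin m × Fin n)} (hl : IsPile l) (h : l ≠ [])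
    {x : Fin m × Fin n} (hx : x ∈ l) : cell l h ≤ x := by
  constructor
  · obtain ⟨l', a, rfl⟩ := List.eq_nil_or_concat'  l |>.resolve_left h
    simp only [cell, List.getLast_append_singleton]
    rcases List.mem_append.1 hx with hx | hx
    · exact ((List.pairwise_append.1 hl).2.2 x hx a (by simp)).1.le
    · simp only [List.mem_singleton] at hx
      rw [hx]
  · obtain ⟨a, l', rfl⟩ := List.exists_cons_of_ne_nil h
    rcases List.mem_cons.1 hx with rfl | hx
    · exact le_rfl
    · exact ((List.pairwise_cons.1 hl).1 x hx).2.le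

theorem mem_firstRow {w : List (Fin m × Fin n)} {c : Fin m × Fin n} (hc : c ∈ firstRow w) :
    (∃ x ∈ w, x.1 = c.1) ∧ ∃ x ∈ w, x.2 = c.2 := by
  induction hN : w.length using Nat.strong_induction_on generalizing w with
  | _ N ih =>
  by_cases hw0 : w = []
  · subst hw0
    simp [firstRow_nil] at hc
  · rw [firstRow_eq hw0] at hc
    rcases List.mem_cons.1 hc with rfl | hc
    · obtain ⟨⟨x, hx, hx'⟩, ⟨y, hy, hy'⟩⟩ := cell_mem (minima_ne_nil hw0)
      exact ⟨⟨x, mem_of_mem_minima hx, hx'⟩, ⟨y, mem_of_mem_minima hy, hy'⟩⟩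
    · obtain ⟨⟨x, hx, hx'⟩, ⟨y, hy, hy'⟩⟩ := ih _ (hN ▸ length_remainder_lt hw0) hc rfl
      exact ⟨⟨x, (remainder_sublist w).subset hx, hx'⟩, ⟨y, (remainder_sublist w).subset hy, hy'⟩⟩

theorem eq_singleton_or_eq_cons_cons (l : List (Fin m × Fin n)) (h : l ≠ []) :
    (∃ a, l = [a]) ∨ ∃ a b t, l = a :: b :: t := by
  match l, h with
  | [a], _ => exact Or.inl ⟨a, rfl⟩
  | a :: b :: t, _ => exact Or.inr ⟨a, b, t, rfl⟩

/-- The block `u` collects initial boxes equal to `z`. Peeling piles, a pile can lengthen a bumped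
chain by one only if it has corners, and then it either adds a box to `u` or contains a biletter
outside the row and column of `z`. A copy of `z` is a pile by itself: it adds a box but no corner.
The count of `z` is therefore gained as slack. -/
theorem exists_split_of_le {w : List (Fin m × Fin n)} (hw : IsSorted w) {z : Fin m × Fin n}
    (hz : ∀ x ∈ w, z ≤ x) :
    ∃ u v, firstRow w = u ++ v ∧ (∀ x ∈ u, x = z) ∧
      ∀ s ≤ (bumped w : Multiset (Fin m × Fin n)), IsChainMultiset s →
        s.card + w.count z ≤ u.length + outside z w := by
  induction hN : w.length using Nat.strong_induction_on generalizing w with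
  | _ N ih =>
  by_cases hw0 : w = []
  · subst hw0
    refine ⟨[], [], rfl, by simp, fun s hs _ => ?_⟩
    have : s = 0 := by simpa [bumped_nil] using hs
    simp [this]
  obtain ⟨u, v, h1, h2, h3⟩ := ih _ (hN ▸ length_remainder_lt hw0) hw.remainder
    (fun x hx => hz x ((remainder_sublist w).subset hx)) rfl
  have hpile := isPile_minima hw
  have hone : ∀ s ≤ (bumped w : Multiset (Fin m × Fin n)), IsChainMultiset s →
      ∃ s' ≤ (bumped (remainder w) : Multiset (Fin m × Fin n)), IsChainMultiset s' ∧ s.card ≤ s'.card + 1 := by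
    intro s hs hc
    rw [Multiset.coe_eq_coe.2 (bumped_perm w), ← Multiset.coe_add] at hs
    exact hc.exists_le_of_pile hpile.corners hs
  have hzero : ∀ a, minima w = [a] → bumped w = bumped (remainder w) := by
    intro a ha
    have := bumped_perm w
    rw [ha] at this
    exact hw.bumped.eq_of_perm hw.remainder.bumped this
  have ho := outside_eq z w
  have hcnt := count_eq z w
  by_cases hzw : z ∈ w
  · have hmin : minima w = [z] := by
      refine hpile.ext (by simp) fun x => ?_
      rw [mem_minima hw, List.mem_singleton]
      constructor
      · rintro ⟨hx, h⟩
        exact (h z hzw (hz x hx)).symm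
      · rintro rfl
        exact ⟨hzw, fun y hy hyx => le_antisymm hyx (hz y hy)⟩
    refine ⟨z :: u, v, ?_, by simpa using h2, fun s hs hc => ?_⟩
    · rw [firstRow_eq hw0, h1]
      simp [hmin, cell]
    · have := h3 s (hzero z hmin ▸ hs) hc
      rw [hmin] at hcnt ho
      simp [outside] at hcnt ho this ⊢
      omega
  · have hcnt0 : w.count z = 0 := List.count_eq_zero.2 hzw
    by_cases hcell : cell (minima w) (minima_ne_nil hw0) = z
    · refine ⟨z :: u, v, ?_, by simpa using h2, fun s hs hc => ?_⟩
      · rw [firstRow_eq hw0, h1, hcell]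
        rfl
      · obtain ⟨s', hs', hc', hcard⟩ := hone s hs hc
        have := h3 s' hs' hc'
        rw [List.length_cons]
        omega
    · have hu : u = [] := by
        by_contra hu
        obtain ⟨x, hx⟩ := List.exists_mem_of_ne_nil u hu
        have hzr : z ∈ firstRow (remainder w) := by
          rw [h1, ← h2 x hx]
          simp [hx]
        obtain ⟨⟨a, ha, ha'⟩, ⟨b, hb, hb'⟩⟩ := mem_firstRow hzr
        obtain ⟨⟨c, hcm, hc'⟩, ⟨d, hdm, hd'⟩⟩ := cell_mem (minima_ne_nil hw0)
        have hle : ∀ x ∈ w, cell (minima w) (minima_ne_nil hw0) ≤ x := fun x hx => by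
          obtain ⟨y, hy, hyx⟩ := exists_minima_le hw hx
          exact (hpile.cell_le _ hy).trans hyx
        refine hcell (Prod.ext ?_ ?_)
        · refine le_antisymm ?_ (hc' ▸ (hz c (mem_of_mem_minima hcm)).1)
          exact ha' ▸ (hle a ((remainder_sublist w).subset ha)).1
        · refine le_antisymm ?_ (hd' ▸ (hz d (mem_of_mem_minima hdm)).2)
          exact hb' ▸ (hle b ((remainder_sublist w).subset hb)).2
      refine ⟨[], firstRow w, rfl, by simp, fun s hs hc => ?_⟩
      rcases eq_singleton_or_eq_cons_cons _ (minima_ne_nil hw0) with ⟨a, ha⟩ | ⟨a, b, t, hab⟩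
      · have := h3 s (hzero a ha ▸ hs) hc
        rw [hu] at this
        simp only [List.length_nil] at this ⊢
        omega
      · obtain ⟨s', hs', hc', hcard⟩ := hone s hs hc
        have h4 := h3 s' hs' hc'
        -- The cell takes its column from the first pile member `a` and its row from the last one
        -- `e`. As the cell is not `z`, one of its coordinates differs from that of `z`: if the
        -- column agrees then `e` is outside, otherwise `a` is.
        have : 0 < outside z (minima w) := by
          have ham : a ∈ minima w := by simp [hab]
          have hlast := List.getLast_mem (minima_ne_nil hw0)
          set e := (minima w).getLast (minima_ne_nil hw0) with he
          have hrel : e.1 < a.1 ∧ a.2 < e.2 := by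
            have : e ∈ b :: t := by
              have : e = (b :: t).getLast (by simp) := by
                simp [he, hab]
              rw [this]
              exact List.getLast_mem _
            rw [hab] at hpile
            exact (List.pairwise_cons.1 hpile).1 e this
          have hce : cell (minima w) (minima_ne_nil hw0) = (e.1, a.2) := by
            simp [cell, hab, he]
          have hza := hz a (mem_of_mem_minima ham)
          have hze := hz e (mem_of_mem_minima hlast)
          by_cases hal : a.2 = z.2
          · refine outside_pos hlast ?_ ?_
            · intro hek
              exact hcell (by rw [hce, hek, hal])
            · exact (lt_of_le_of_lt hza.2 hrel.2).ne'
          · exact outside_pos ham (lt_of_le_of_lt hze.1 hrel.1).ne' hal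
        rw [hu] at h4
        simp only [List.length_nil] at h4 ⊢
        omega

/-- An extra copy changes the set of minimal biletters only if it is new and minimal itself. -/
theorem minima_eq_of_perm_cons {w w₀ : List (Fin m × Fin n)} {z : Fin m × Fin n}
    (hw : IsSorted w) (hw₀ : IsSorted w₀) (hp : w.Perm (z :: w₀)) (h : z ∈ minima w → z ∈ w₀) :
    minima w = minima w₀ := by
  have hmem : ∀ x, x ∈ w ↔ x = z ∨ x ∈ w₀ := fun x => by rw [hp.mem_iff, List.mem_cons]
  refine (isPile_minima hw).ext (isPile_minima hw₀) fun x => ?_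
  by_cases hz : z ∈ w₀
  · have : ∀ x, x ∈ w ↔ x ∈ w₀ := fun x => by
      rw [hmem]
      constructor
      · rintro (rfl | h)
        · exact hz
        · exact h
      · exact Or.inr
    simp only [mem_minima hw, mem_minima hw₀, this]
  · have hzm : z ∉ minima w := fun h' => hz (h h')
    obtain ⟨y, hy, hyz⟩ := exists_minima_le hw ((hmem z).2 (Or.inl rfl))
    have hyz' : y ≠ z := fun h => hzm (h ▸ hy)
    have hyw : y ∈ w₀ := ((hmem y).1 (mem_of_mem_minima hy)).resolve_left hyz'
    rw [mem_minima hw₀]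
    constructor
    · intro hx
      have hxz : x ≠ z := fun h => hzm (h ▸ hx)
      have := (mem_minima hw).1 hx
      exact ⟨((hmem x).1 this.1).resolve_left hxz, fun y hy => this.2 y ((hmem y).2 (Or.inr hy))⟩
    · rintro ⟨hx, hx'⟩
      rw [mem_minima hw]
      refine ⟨(hmem x).2 (Or.inr hx), fun t ht htx => ?_⟩
      rcases (hmem t).1 ht with rfl | ht
      · have := hx' y hyw (hyz.trans htx)
        subst this
        exact le_antisymm htx hyz
      · exact hx' t ht htx

/-- As long as the first pile is not `z` alone, it is the same for both words, and its removal
preserves the hypothesis `hlt`. Once the pile is `z` alone, every remaining biletter lies above `z`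
and `exists_split_of_le` applies. Together with `hlt` the final bound says that chains in the bumped
word, hence all lower rows, are no longer than `u`. -/
theorem exists_split_firstRow {w w₀ : List (Fin m × Fin n)} {z : Fin m × Fin n}
    (hw : IsSorted w) (hw₀ : IsSorted w₀) (hp : w.Perm (z :: w₀))
    (hlt : outside z w < w.count z) :
    ∃ u v, firstRow w = u ++ z :: v ∧ firstRow w₀ = u ++ v ∧ bumped w = bumped w₀ ∧
      ∀ s ≤ (bumped w : Multiset (Fin m × Fin n)), IsChainMultiset s →
        s.card + w.count z ≤ u.length + 1 + outside z w := by
  induction hN : w.length using Nat.strong_induction_on generalizing w w₀ with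
  | _ N ih =>
  have hw0 : w ≠ [] := by
    rintro rfl
    simp at hp
  have hpile := isPile_minima hw
  have ho := outside_eq z w
  have hcnt := count_eq z w
  by_cases hmin : minima w = [z]
  · have hrem : remainder w = w₀ := by
      refine hw.remainder.eq_of_perm hw₀ ?_
      have := (minima_append_remainder w).trans hp
      rw [hmin] at this
      exact (List.perm_cons z).1 this
    obtain ⟨u, v, h1, h2, h3⟩ := exists_split_of_le hw₀ (z := z) fun x hx => by
      have hxw : x ∈ w := hp.mem_iff.2 (List.mem_cons_of_mem _ hx)
      obtain ⟨y, hy, hyx⟩ := exists_minima_le hw hxw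
      rw [hmin, List.mem_singleton] at hy
      exact hy ▸ hyx
    have hb : bumped w = bumped w₀ := by
      have := bumped_perm w
      rw [hmin, hrem] at this
      exact hw.bumped.eq_of_perm hw₀.bumped this
    refine ⟨u, v, ?_, h1, hb, fun s hs hc => ?_⟩
    · rw [firstRow_eq hw0, hrem, h1]
      have hu := List.eq_replicate_of_mem h2
      -- The deleted box is moved behind the block `u` of equal boxes, so that `u` in front of it is
      -- long enough for the chain bound.
      have : z :: u = u ++ [z] := by
        rw [hu, ← List.replicate_succ, List.replicate_succ']
      have h4 : cell (minima w) (minima_ne_nil hw0) = z := by simp [hmin, cell]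
      rw [h4, ← List.cons_append, this]
      simp
    · have := h3 s (hb ▸ hs) hc
      rw [hmin, hrem] at hcnt ho
      simp [outside] at hcnt ho this ⊢
      omega
  · have hother : z ∈ minima w → 0 < outside z (minima w) ∧ (minima w).count z = 1 := by
      intro hz
      refine ⟨?_, List.count_eq_one_of_mem hpile.nodup hz⟩
      by_contra hout
      refine hmin (hpile.ext (by simp) fun x => ?_)
      rw [List.mem_singleton]
      refine ⟨fun hx => ?_, fun h => h ▸ hz⟩
      by_contra hxz
      have : Std.Symm fun a b : Fin m × Fin n =>
          b.1 < a.1 ∧ a.2 < b.2 ∨ a.1 < b.1 ∧ b.2 < a.2 := ⟨fun _ _ h => h.symm⟩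
      have hrel := List.Pairwise.forall (R := fun a b : Fin m × Fin n =>
        b.1 < a.1 ∧ a.2 < b.2 ∨ a.1 < b.1 ∧ b.2 < a.2)
        (hpile.imp fun h => Or.inl h) hx hz hxz
      rcases hrel with h | h
      · exact hout (outside_pos hx h.1.ne' h.2.ne)
      · exact hout (outside_pos hx h.1.ne h.2.ne')
    -- With an outside biletter present, strict dominance gives at least two copies of `z`, so one
    -- survives the deletion.
    have hzw₀ : z ∈ minima w → z ∈ w₀ := by
      intro hz
      have h1 := (hother hz).1
      rw [hp.count_eq, List.count_cons_self] at hlt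
      exact List.count_pos_iff.1 (by omega)
    have hme := minima_eq_of_perm_cons hw hw₀ hp hzw₀
    have hrem : (remainder w).Perm (z :: remainder w₀) := by
      have h1 := (minima_append_remainder w).trans
        (hp.trans ((minima_append_remainder w₀).symm.cons z))
      rw [hme] at h1
      exact (List.perm_append_left_iff _).1 (h1.trans List.perm_middle.symm)
    have hcount0 : z ∉ minima w → (minima w).count z = 0 := fun h => List.count_eq_zero.2 h
    have hlt' : outside z (remainder w) < (remainder w).count z := by
      by_cases hz : z ∈ minima w
      · have := hother hz
        omega
      · have := hcount0 hz
        omega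
    obtain ⟨u, v, h1, h2, h3, h4⟩ :=
      ih _ (hN ▸ length_remainder_lt hw0) hw.remainder hw₀.remainder hrem hlt' rfl
    have hw₀0 : w₀ ≠ [] := by
      rintro rfl
      exact minima_ne_nil hw0 (by rw [hme]; rfl)
    refine ⟨cell (minima w) (minima_ne_nil hw0) :: u, v, ?_, ?_, ?_, fun s hs hc => ?_⟩
    · rw [firstRow_eq hw0, h1]
      rfl
    · rw [firstRow_eq hw₀0, h2]
      simp only [hme]
      rfl
    · refine hw.bumped.eq_of_perm hw₀.bumped ((bumped_perm w).trans ?_)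
      rw [hme, h3]
      exact (bumped_perm w₀).symm
    · rw [Multiset.coe_eq_coe.2 (bumped_perm w), ← Multiset.coe_add] at hs
      obtain ⟨s', hs', hc', hcard⟩ := hc.exists_le_of_pile hpile.corners hs
      have h5 := h4 s' hs' hc'
      rw [List.length_cons]
      by_cases hz : z ∈ minima w
      · have := hother hz
        omega
      · have := hcount0 hz
        omega

end BlockRSK

/-! ### Bitableaux, the grading by margins, and the invariances of the matrix entries -/

namespace BlockRSK

open MvPolynomial

variable {m n : ℕ}

/-! ### Bitableaux -/

theorem minor_eq {L : List (Fin m × Fin n)} {N : ℕ} (h : L.length = N) :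
    minor L = Matrix.det (Matrix.of fun i j : Fin N =>
      (X ((L.get (i.cast h.symm)).1, (L.get (j.cast h.symm)).2) :
        MvPolynomial (Fin m × Fin n) ℂ)) := by
  subst h
  rfl

theorem minor_singleton (z : Fin m × Fin n) : minor [z] = X z := by
  rw [minor_eq (N := 1) rfl, Matrix.det_fin_one]
  simp

theorem minor_map_swap (L : List (Fin m × Fin n)) :
    minor (L.map Prod.swap) = rename Prod.swap (minor L) := by
  rw [minor_eq (L := L.map Prod.swap) (N := L.length) (by simp), minor, AlgHom.map_det,
    ← Matrix.det_transpose]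
  congr 1
  ext i j : 2
  simp [Matrix.transpose_apply]

theorem minor_map_map {m' n' : ℕ} (f : Fin m → Fin m') (g : Fin n → Fin n')
    (L : List (Fin m × Fin n)) :
    minor (L.map (Prod.map f g)) = rename (Prod.map f g) (minor L) := by
  rw [minor_eq (L := L.map (Prod.map f g)) (N := L.length) (by simp), minor, AlgHom.map_det]
  congr 1
  ext i j : 2
  simp

theorem column_map {m' n' : ℕ} (f : Fin m × Fin n → Fin m' × Fin n') (T : TableauPair m n)
    (c : ℕ) : column (T.map (List.map f)) c = (column T c).map f := by
  simp [column, List.filterMap_map, List.map_filterMap]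

theorem length_headD_map {m' n' : ℕ} (f : Fin m × Fin n → Fin m' × Fin n') (T : TableauPair m n) :
    ((T.map (List.map f)).headD []).length = (T.headD []).length := by
  cases T <;> simp

theorem bitableau_map_swap (T : TableauPair m n) :
    bitableau (T.map (List.map Prod.swap)) = rename Prod.swap (bitableau T) := by
  rw [bitableau, length_headD_map, bitableau, map_list_prod, List.map_map]
  congr 1
  refine List.map_congr_left fun c _ => ?_
  rw [column_map, minor_map_swap]
  rfl

theorem bitableau_map_map {m' n' : ℕ} (f : Fin m → Fin m') (g : Fin n → Fin n')
    (T : TableauPair m n) :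
    bitableau (T.map (List.map (Prod.map f g))) = rename (Prod.map f g) (bitableau T) := by
  rw [bitableau, length_headD_map, bitableau, map_list_prod, List.map_map]
  congr 1
  refine List.map_congr_left fun c _ => ?_
  rw [column_map, minor_map_map]
  rfl

theorem bitableau_cons (r : List (Fin m × Fin n)) (T : TableauPair m n) :
    bitableau (r :: T) = ∏ c ∈ Finset.range r.length, minor (column (r :: T) c) := by
  rw [bitableau, Finset.prod_range, List.headD_cons, ← List.prod_ofFn]
  congr 1
  rw [List.map_eq_iff]
  simp [List.getElem?_ofFn]
  intro i
  by_cases h : i < r.length <;> simp [h]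

theorem column_cons (r : List (Fin m × Fin n)) (T : TableauPair m n) (c : ℕ) :
    column (r :: T) c = r[c]?.toList ++ column T c := by
  rw [column, List.filterMap_cons]
  cases r[c]? <;> rfl

theorem column_eq_nil {T : TableauPair m n} {c : ℕ} (h : ∀ r ∈ T, r.length ≤ c) :
    column T c = [] := by
  rw [column, List.filterMap_eq_nil_iff]
  intro r hr
  simpa using h r hr

/-- From position `u.length` on, all columns are single boxes of the first row. Inserting `z` there
shifts the later ones and leaves the columns under `u` untouched. -/
theorem bitableau_cons_insert (u v : List (Fin m × Fin n)) (z : Fin m × Fin n)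
    (T : TableauPair m n) (h : ∀ r ∈ T, r.length ≤ u.length) :
    bitableau ((u ++ z :: v) :: T) = X z * bitableau ((u ++ v) :: T) := by
  have hT : ∀ c, column T (u.length + c) = [] := fun c =>
    column_eq_nil fun r hr => (h r hr).trans (Nat.le_add_right _ _)
  rw [bitableau_cons, bitableau_cons, List.length_append, List.length_append, List.length_cons,
    Finset.prod_range_add _ u.length (v.length + 1), Finset.prod_range_add _ u.length v.length,
    Finset.prod_range_succ']
  have h1 : ∀ v' : List (Fin m × Fin n), ∀ c ∈ Finset.range u.length,
      minor (column ((u ++ v') :: T) c) = minor (u[c]?.toList ++ column T c) := by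
    intro v' c hc
    rw [column_cons, List.getElem?_append_left (Finset.mem_range.1 hc)]
  rw [Finset.prod_congr rfl (h1 (z :: v)), Finset.prod_congr rfl (h1 v)]
  have h2 : ∀ v' : List (Fin m × Fin n), ∀ c,
      column ((u ++ v') :: T) (u.length + c) = v'[c]?.toList := by
    intro v' c
    rw [column_cons, hT, List.append_nil, List.getElem?_append_right (Nat.le_add_right _ _),
      Nat.add_sub_cancel_left]
  simp only [h2, List.getElem?_cons_succ, List.getElem?_cons_zero, Option.toList_some,
    minor_singleton]
  ring

theorem bitableau_insertWord (w : List (Fin m × Fin n)) :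
    bitableau (insertWord [] w) = bitableau (firstRow w :: insertWord [] (bumped w)) := by
  by_cases hw : w = []
  · subst hw
    simp [insertWord, firstRow_nil, bumped_nil, bitableau]
  · rw [insertWord_nil_eq hw]

/-- A biletter that occurs more often than all biletters that share no component with it
contributes a factor to the bitableau. -/
theorem bitableau_insertWord_cons {w w₀ : List (Fin m × Fin n)} {z : Fin m × Fin n}
    (hw : IsSorted w) (hw₀ : IsSorted w₀) (hp : w.Perm (z :: w₀))
    (hlt : outside z w < w.count z) :
    bitableau (insertWord [] w) = X z * bitableau (insertWord [] w₀) := by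
  obtain ⟨u, v, h1, h2, h3, h4⟩ := exists_split_firstRow hw hw₀ hp hlt
  rw [bitableau_insertWord, bitableau_insertWord w₀, h1, h2, ← h3]
  refine bitableau_cons_insert u v z _ fun r hr => ?_
  refine (length_le_of_mem_insertWord hw.bumped hr).trans
    (length_firstRow_bumped_le hw fun s hs hc => ?_)
  have := h4 s hs hc
  omega

/-! ### The word of an exponent matrix -/

theorem isSorted_biword (α : Fin m × Fin n →₀ ℕ) : IsSorted (biword α) := by
  rw [IsSorted, biword, List.pairwise_flatMap]
  refine ⟨fun j _ => ?_, (List.pairwise_lt_finRange n).imp fun {j j'} h x hx y hy => ?_⟩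
  · rw [List.pairwise_flatMap]
    refine ⟨fun i _ => ?_, (List.pairwise_lt_finRange m).imp fun {i i'} h x hx y hy => ?_⟩
    · rw [List.pairwise_replicate]
      exact Or.inr (Or.inr ⟨rfl, le_rfl⟩)
    · rw [List.eq_of_mem_replicate hx, List.eq_of_mem_replicate hy]
      exact Or.inr ⟨rfl, h.le⟩
  · simp only [List.mem_flatMap] at hx hy
    obtain ⟨_, _, hx⟩ := hx
    obtain ⟨_, _, hy⟩ := hy
    rw [List.eq_of_mem_replicate hx, List.eq_of_mem_replicate hy]
    exact Or.inl h

theorem count_biword (α : Fin m × Fin n →₀ ℕ) (z : Fin m × Fin n) :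
    (biword α).count z = α z := by
  rw [biword, List.count_flatMap, ← Fin.sum_univ_def]
  have h : ∀ j : Fin n, (List.count z ∘ fun j => (List.finRange m).flatMap fun i =>
      List.replicate (α (i, j)) (i, j)) j = if j = z.2 then α z else 0 := by
    intro j
    rw [Function.comp_apply, List.count_flatMap, ← Fin.sum_univ_def]
    have h : ∀ i : Fin m, (List.count z ∘ fun i => List.replicate (α (i, j)) (i, j)) i =
        if i = z.1 then (if j = z.2 then α z else 0) else 0 := by
      intro i
      rw [Function.comp_apply, List.count_replicate]
      rcases z with ⟨k, l⟩
      by_cases hi : i = k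
      · by_cases hj : j = l
        · simp [hi, hj]
        · simp [hj, Prod.ext_iff]
      · simp [hi, Prod.ext_iff]
    exact (Finset.sum_congr rfl fun i _ => h i).trans (by simp)
  exact (Finset.sum_congr rfl fun j _ => h j).trans (by simp)

theorem eq_biword {α : Fin m × Fin n →₀ ℕ} {w : List (Fin m × Fin n)} (hw : IsSorted w)
    (h : ∀ z, w.count z = α z) : w = biword α :=
  hw.eq_of_perm (isSorted_biword α)
    (List.perm_iff_count.2 fun z => by rw [h, count_biword])

theorem rsk_eq (α : Fin m × Fin n →₀ ℕ) : rsk α = insertWord [] (biword α) := rfl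

theorem countP_eq_sum_count {ι : Type*} [Fintype ι] [BEq ι] [LawfulBEq ι] (p : ι → Prop)
    [DecidablePred p] (w : List ι) : w.countP (fun x => decide (p x)) = ∑ x with p x, w.count x := by
  induction w with
  | nil => simp
  | cons a w ih =>
    classical
    simp only [List.countP_cons, ih, List.count_cons, Finset.sum_add_distrib]
    simp [Finset.sum_filter]

theorem sum_map_eq_sum_count {ι M : Type*} [Fintype ι] [BEq ι] [LawfulBEq ι] [AddCommMonoid M]
    (f : ι → M) (w : List ι) : (w.map f).sum = ∑ x, w.count x • f x := by
  classical
  induction w with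
  | nil => simp
  | cons a w ih =>
    simp [ih, List.count_cons, add_smul, Finset.sum_add_distrib, add_comm]

/-- Inclusion–exclusion: the row and the column through `z` overlap in `z`. It translates dominance
of a biletter into a condition on margins. -/
theorem outside_biword (α : Fin m × Fin n →₀ ℕ) (z : Fin m × Fin n) :
    outside z (biword α) + ∑ j, α (z.1, j) + ∑ i, α (i, z.2) = ∑ x, α x + α z := by
  have h1 : outside z (biword α) = ∑ x with x.1 ≠ z.1 ∧ x.2 ≠ z.2, α x := by
    rw [outside, countP_eq_sum_count]
    simp only [count_biword]
  have h2 : ∑ j, α (z.1, j) = ∑ x with x.1 = z.1, α x := by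
    rw [Finset.sum_filter, Fintype.sum_prod_type, Finset.sum_comm]
    simp
  have h3 : ∑ i, α (i, z.2) = ∑ x with x.2 = z.2, α x := by
    rw [Finset.sum_filter, Fintype.sum_prod_type]
    simp
  have h4 : α z = ∑ x, if x = z then α x else 0 := by simp
  rw [h1, h2, h3, h4, Finset.sum_filter, Finset.sum_filter, Finset.sum_filter,
    ← Finset.sum_add_distrib, ← Finset.sum_add_distrib, ← Finset.sum_add_distrib]
  refine Finset.sum_congr rfl fun x _ => ?_
  rcases x with ⟨i, j⟩
  rcases z with ⟨k, l⟩
  by_cases hi : i = k <;> by_cases hj : j = l <;> simp [hi, hj]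

/-! ### Weights -/

/-- The weight of a biletter. -/
def letterWeight (x : Fin m × Fin n) : (Fin m → ℕ) × (Fin n → ℕ) :=
  (Pi.single x.1 1, Pi.single x.2 1)

/-- The weight of a word. -/
def wordWeight (w : List (Fin m × Fin n)) : (Fin m → ℕ) × (Fin n → ℕ) :=
  (w.map letterWeight).sum

/-- The row sums and the column sums of an exponent matrix. -/
def margins (α : Fin m × Fin n →₀ ℕ) : (Fin m → ℕ) × (Fin n → ℕ) :=
  (fun i => ∑ j, α (i, j), fun j => ∑ i, α (i, j))

theorem wordWeight_cons (x : Fin m × Fin n) (w : List (Fin m × Fin n)) :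
    wordWeight (x :: w) = letterWeight x + wordWeight w := by
  simp [wordWeight]

theorem wordWeight_append (v w : List (Fin m × Fin n)) :
    wordWeight (v ++ w) = wordWeight v + wordWeight w := by
  simp [wordWeight]

theorem wordWeight_nil : wordWeight ([] : List (Fin m × Fin n)) = 0 := rfl

theorem sum_smul_letterWeight (α : Fin m × Fin n →₀ ℕ) :
    ∑ x, α x • letterWeight x = margins α := by
  rw [margins]
  refine Prod.ext ?_ ?_
  · rw [Prod.fst_sum]
    ext i
    rw [Finset.sum_apply, Fintype.sum_prod_type, Finset.sum_comm]
    simp [letterWeight, Pi.single_apply]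
  · rw [Prod.snd_sum]
    ext i
    simp [letterWeight, Fintype.sum_prod_type, Pi.single_apply]

theorem weight_letterWeight (α : Fin m × Fin n →₀ ℕ) :
    Finsupp.weight letterWeight α = margins α := by
  rw [Finsupp.weight_apply, Finsupp.sum_fintype _ _ (by simp), sum_smul_letterWeight]

theorem wordWeight_biword (α : Fin m × Fin n →₀ ℕ) : wordWeight (biword α) = margins α := by
  rw [wordWeight, sum_map_eq_sum_count, ← sum_smul_letterWeight]
  simp only [count_biword]

theorem bump_weight {p p' : Fin m} {q : Fin n} {r r' : List (Fin m × Fin n)}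
    (h : bump p r = some (p', r')) :
    wordWeight r' + letterWeight (p', q) = wordWeight r + letterWeight (p, q) := by
  induction r generalizing r' with
  | nil => simp [bump] at h
  | cons c r ih =>
    by_cases hc : p < c.1
    · simp only [bump, hc, if_true, Option.some.injEq, Prod.mk.injEq] at h
      obtain ⟨rfl, rfl⟩ := h
      rw [wordWeight_cons, wordWeight_cons]
      refine Prod.ext ?_ ?_
      · simp only [letterWeight, Prod.fst_add]
        abel
      · simp only [letterWeight, Prod.snd_add]
    · simp only [bump, hc, if_false, Option.map_eq_some_iff, Prod.mk.injEq, Prod.exists] at h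
      obtain ⟨a, s, hs, rfl, rfl⟩ := h
      rw [wordWeight_cons, wordWeight_cons, add_assoc, add_assoc, ih hs]

theorem insertBiletter_weight (q : Fin n) (T : TableauPair m n) (p : Fin m) :
    wordWeight (insertBiletter q T p).flatten = wordWeight T.flatten + letterWeight (p, q) := by
  induction T generalizing p with
  | nil => simp [insertBiletter, wordWeight]
  | cons r T ih =>
    rw [insertBiletter]
    rcases h : bump p r with _ | ⟨p', r'⟩
    · simp only [List.flatten_cons, wordWeight_append, wordWeight_cons, wordWeight_nil]
      abel
    · simp only [List.flatten_cons, wordWeight_append, ih]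
      rw [add_left_comm, bump_weight h]
      abel

theorem insertWord_weight (T : TableauPair m n) (w : List (Fin m × Fin n)) :
    wordWeight (insertWord T w).flatten = wordWeight T.flatten + wordWeight w := by
  induction w generalizing T with
  | nil => simp [insertWord, wordWeight_nil]
  | cons b w ih =>
    change wordWeight (insertWord (insertBiletter b.2 T b.1) w).flatten = _
    rw [ih, insertBiletter_weight, wordWeight_cons, add_assoc]

/-- A permutation in the expansion changes only the pairing of row indices with column indices, not
the two multisets of indices. -/
theorem minor_homogeneous (L : List (Fin m × Fin n)) :
    IsWeightedHomogeneous letterWeight (minor L) (wordWeight L) := by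
  rw [minor, Matrix.det_apply]
  refine IsWeightedHomogeneous.sum _ _ _ fun σ _ => ?_
  rw [← mem_weightedHomogeneousSubmodule, Units.smul_def]
  refine zsmul_mem ?_ _
  rw [mem_weightedHomogeneousSubmodule]
  have h := IsWeightedHomogeneous.prod (w := letterWeight) Finset.univ
    (fun i : Fin L.length => (X ((L.get (σ i)).1, (L.get i).2) : MvPolynomial (Fin m × Fin n) ℂ))
    (fun i => letterWeight ((L.get (σ i)).1, (L.get i).2))
    fun i _ => isWeightedHomogeneous_X _ _ _
  refine Eq.mp (congrArg _ ?_) h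
  have h1 : wordWeight L = ∑ i : Fin L.length, letterWeight (L.get i) := by
    rw [wordWeight, ← List.sum_ofFn]
    congr 1
    conv_lhs => rw [← List.ofFn_get L, List.map_ofFn]
    rfl
  rw [h1]
  refine Prod.ext ?_ ?_
  · rw [Prod.fst_sum, Prod.fst_sum]
    exact Equiv.sum_comp σ fun i => (Pi.single (L.get i).1 1 : Fin m → ℕ)
  · rw [Prod.snd_sum, Prod.snd_sum]
    rfl

theorem sum_weight_getElem? (r : List (Fin m × Fin n)) {N : ℕ} (h : r.length ≤ N) :
    ∑ c ∈ Finset.range N, wordWeight (r[c]?.toList) = wordWeight r := by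
  induction r generalizing N with
  | nil => simp [wordWeight]
  | cons a r ih =>
    obtain ⟨N, rfl⟩ : ∃ M, N = M + 1 := ⟨N - 1, by simp at h; omega⟩
    rw [Finset.sum_range_succ', wordWeight_cons]
    simp only [List.getElem?_cons_succ, List.getElem?_cons_zero, Option.toList_some]
    rw [ih (by simpa using h), wordWeight_cons, wordWeight_nil, add_zero, add_comm]

theorem sum_weight_column {T : TableauPair m n} {N : ℕ} (h : ∀ r ∈ T, r.length ≤ N) :
    ∑ c ∈ Finset.range N, wordWeight (column T c) = wordWeight T.flatten := by
  induction T with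
  | nil => simp [column, wordWeight]
  | cons r T ih =>
    simp only [column_cons, wordWeight_append, Finset.sum_add_distrib, List.flatten_cons]
    rw [sum_weight_getElem? r (h r (by simp)), ih fun s hs => h s (by simp [hs])]

/-- The product runs over the columns of the first row only, so the first row has to be the longest
for every box to be counted. -/
theorem bitableau_homogeneous {T : TableauPair m n} (h : ∀ r ∈ T, r.length ≤ (T.headD []).length) :
    IsWeightedHomogeneous letterWeight (bitableau T) (wordWeight T.flatten) := by
  cases T with
  | nil => exact isWeightedHomogeneous_one _ _
  | cons r T =>
    rw [bitableau_cons, ← sum_weight_column h]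
    exact IsWeightedHomogeneous.prod _ _ _ fun c _ => minor_homogeneous _

theorem bitableau_rsk_homogeneous (α : Fin m × Fin n →₀ ℕ) :
    IsWeightedHomogeneous letterWeight (bitableau (rsk α)) (margins α) := by
  have h : wordWeight (rsk α).flatten = margins α := by
    rw [rsk_eq, insertWord_weight, wordWeight_biword]
    simp [wordWeight_nil]
  rw [← h]
  refine bitableau_homogeneous fun r hr => ?_
  rw [rsk_eq] at hr ⊢
  by_cases hw : biword α = []
  · rw [hw] at hr
    simp [insertWord] at hr
  · have := length_le_of_mem_insertWord (isSorted_biword α) hr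
    rwa [insertWord_nil_eq hw]

/-! ### Matrix entries -/

/-- The entry of the matrix of the operator at `(β, α)`. -/
noncomputable def entry (β α : Fin m × Fin n →₀ ℕ) : ℂ := coeff β (bitableau (rsk α))

theorem rskOperator_monomial (α : Fin m × Fin n →₀ ℕ) :
    rskOperator m n (monomial α 1) = bitableau (rsk α) := by
  have := (basisMonomials (Fin m × Fin n) ℂ).constr_basis ℂ (fun α => bitableau (rsk α)) α
  rwa [coe_basisMonomials] at this

theorem entry_eq_zero {β α : Fin m × Fin n →₀ ℕ} (h : margins β ≠ margins α) : entry β α = 0 :=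
  (bitableau_rsk_homogeneous α).coeff_eq_zero β (by rwa [weight_letterWeight])

theorem entry_zero : entry (0 : Fin m × Fin n →₀ ℕ) 0 = 1 := by
  have : biword (0 : Fin m × Fin n →₀ ℕ) = [] := (eq_biword (by simp) (by simp)).symm
  rw [entry, rsk_eq, this]
  simp [insertWord, bitableau]

theorem entry_swap {β α : Fin m × Fin n →₀ ℕ} {β' α' : Fin n × Fin m →₀ ℕ}
    (hβ : ∀ x, β' x.swap = β x) (hα : ∀ x, α' x.swap = α x) : entry β' α' = entry β α := by
  have h1 : bitableau (rsk α') = rename Prod.swap (bitableau (rsk α)) := by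
    rw [rsk_eq, rsk_eq, ← bitableau_map_swap, insertWord_swap (isSorted_biword α)
      (isSorted_biword α')]
    refine List.perm_iff_count.2 fun z => ?_
    obtain ⟨z, rfl⟩ := Prod.swap_surjective z
    rw [List.count_map_of_injective _ _ Prod.swap_injective, count_biword, count_biword, hα]
  have h2 : β' = β.mapDomain Prod.swap := by
    ext x
    obtain ⟨x, rfl⟩ := Prod.swap_surjective x
    rw [Finsupp.mapDomain_apply Prod.swap_injective, hβ]
  rw [entry, h1, h2, coeff_rename_mapDomain _ Prod.swap_injective, entry]

theorem bump_map {m' n' : ℕ} {f : Fin m → Fin m'} (hf : StrictMono f) (g : Fin n → Fin n')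
    (p : Fin m) (r : List (Fin m × Fin n)) :
    bump (f p) (r.map (Prod.map f g)) =
      (bump p r).map fun x => (f x.1, x.2.map (Prod.map f g)) := by
  induction r with
  | nil => rfl
  | cons c r ih =>
    by_cases hc : p < c.1
    · simp [bump, hc, hf.lt_iff_lt]
    · simp [bump, hc, hf.lt_iff_lt, ih, Function.comp_def]

theorem insertBiletter_map {m' n' : ℕ} {f : Fin m → Fin m'} (hf : StrictMono f)
    (g : Fin n → Fin n') (q : Fin n) (T : TableauPair m n) (p : Fin m) :
    insertBiletter (g q) (T.map (List.map (Prod.map f g))) (f p) =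
      (insertBiletter q T p).map (List.map (Prod.map f g)) := by
  induction T generalizing p with
  | nil => rfl
  | cons r T ih =>
    rw [List.map_cons, insertBiletter, insertBiletter, bump_map hf]
    rcases bump p r with _ | ⟨p', r'⟩
    · simp
    · simp [ih]

theorem insertWord_map {m' n' : ℕ} {f : Fin m → Fin m'} (hf : StrictMono f)
    (g : Fin n → Fin n') (T : TableauPair m n) (w : List (Fin m × Fin n)) :
    insertWord (T.map (List.map (Prod.map f g))) (w.map (Prod.map f g)) =
      (insertWord T w).map (List.map (Prod.map f g)) := by
  induction w generalizing T with
  | nil => rfl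
  | cons b w ih =>
    change insertWord (insertBiletter (g b.2) (T.map (List.map (Prod.map f g))) (f b.1))
      (w.map (Prod.map f g)) = (insertWord (insertBiletter b.2 T b.1) w).map _
    rw [insertBiletter_map hf, ih]

/-- Insertion depends only on comparisons of labels, and the reading order is preserved by strictly
increasing relabellings. -/
theorem entry_mapDomain {m' n' : ℕ} {f : Fin m → Fin m'} {g : Fin n → Fin n'} (hf : StrictMono f)
    (hg : StrictMono g) (β α : Fin m × Fin n →₀ ℕ) :
    entry (β.mapDomain (Prod.map f g)) (α.mapDomain (Prod.map f g)) = entry β α := by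
  have hinj : Function.Injective (Prod.map f g) := hf.injective.prodMap hg.injective
  have h1 : biword (α.mapDomain (Prod.map f g)) = (biword α).map (Prod.map f g) := by
    refine (eq_biword ?_ fun z => ?_).symm
    · rw [IsSorted, List.pairwise_map]
      refine (isSorted_biword α).imp fun h => h.imp (fun h => hg h) fun h => ?_
      exact ⟨congrArg g h.1, hf.monotone h.2⟩
    · by_cases hz : z ∈ Set.range (Prod.map f g)
      · obtain ⟨x, rfl⟩ := hz
        rw [List.count_map_of_injective _ _ hinj, count_biword, Finsupp.mapDomain_apply hinj]
      · rw [Finsupp.mapDomain_of_notMem_range _ _ hz, List.count_eq_zero]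
        intro h
        obtain ⟨x, -, hx⟩ := List.mem_map.1 h
        exact hz ⟨x, hx⟩
  have h2 : rsk (α.mapDomain (Prod.map f g)) = (rsk α).map (List.map (Prod.map f g)) := by
    rw [rsk_eq, rsk_eq, h1, ← insertWord_map hf]
    rfl
  rw [entry, h2, bitableau_map_map, coeff_rename_mapDomain _ hinj, entry]

/-- By `outside_biword` the hypothesis says that at most `α z` biletters lie outside; one more copy
of `z` makes it dominant and multiplies the bitableau by `X z`. -/
theorem entry_add_single {β α : Fin m × Fin n →₀ ℕ} {z : Fin m × Fin n}
    (h : ∑ x, α x ≤ ∑ j, α (z.1, j) + ∑ i, α (i, z.2)) :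
    entry (β + Finsupp.single z 1) (α + Finsupp.single z 1) = entry β α := by
  have hp : (biword (α + Finsupp.single z 1)).Perm (z :: biword α) := by
    refine List.perm_iff_count.2 fun x => ?_
    rw [count_biword, List.count_cons, count_biword, Finsupp.add_apply, Finsupp.single_apply]
    simp
  have hout : outside z (biword (α + Finsupp.single z 1)) = outside z (biword α) := by
    rw [outside, hp.countP_eq]
    simp [outside]
  have hlt : outside z (biword (α + Finsupp.single z 1)) <
      (biword (α + Finsupp.single z 1)).count z := by
    rw [hout, count_biword]
    have := outside_biword α z
    simp
    omega
  rw [entry, rsk_eq, bitableau_insertWord_cons (isSorted_biword _) (isSorted_biword _) hp hlt,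
    add_comm β, coeff_X_mul', ← rsk_eq]
  simp [entry]

end BlockRSK

/-! ### Confluence of the variable-multiplication poset and counting above a reduced pair -/

namespace BlockRSK

variable {r s : ℕ}

/-! ### The variable-multiplication poset -/

/-- All entries are nonzero. -/
def IsPositive (x : (Fin r → ℕ) × (Fin s → ℕ)) : Prop := (∀ i, x.1 i ≠ 0) ∧ ∀ j, x.2 j ≠ 0

/-- The two vectors have the same sum. -/
def IsBalanced (x : (Fin r → ℕ) × (Fin s → ℕ)) : Prop := ∑ i, x.1 i = ∑ j, x.2 j

/-- No down-step leads out of `x`. -/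
def IsReduced (x : (Fin r → ℕ) × (Fin s → ℕ)) : Prop := ∀ k l, x.1 k + x.2 l ≤ ∑ i, x.1 i

theorem sum_add_single (f : Fin r → ℕ) (k : Fin r) (c : ℕ) :
    ∑ i, (f + Pi.single k c : Fin r → ℕ) i = ∑ i, f i + c := by
  simp [Finset.sum_add_distrib, Pi.single_apply]

theorem add_le_sum (f : Fin r → ℕ) {k k' : Fin r} (h : k ≠ k') : f k + f k' ≤ ∑ i, f i := by
  rw [← Finset.sum_pair h]
  exact Finset.sum_le_sum_of_subset (Finset.subset_univ _)

theorem le_sum (f : Fin r → ℕ) (k : Fin r) : f k ≤ ∑ i, f i :=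
  Finset.single_le_sum (fun _ _ => Nat.zero_le _) (Finset.mem_univ k)

theorem sub_single_add (f : Fin r → ℕ) {k : Fin r} (h : f k ≠ 0) :
    f - Pi.single k 1 + Pi.single k 1 = f := by
  ext i
  by_cases hi : i = k
  · subst hi
    simp
    omega
  · simp [hi]

theorem IsPositive.swap {x : (Fin r → ℕ) × (Fin s → ℕ)} (h : IsPositive x) :
    IsPositive x.swap :=
  ⟨h.2, h.1⟩

theorem IsBalanced.swap {x : (Fin r → ℕ) × (Fin s → ℕ)} (h : IsBalanced x) :
    IsBalanced x.swap :=
  Eq.symm h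

theorem IsReduced.swap {x : (Fin r → ℕ) × (Fin s → ℕ)} (h : IsReduced x) (hb : IsBalanced x) :
    IsReduced x.swap := fun k l => by
  rw [Prod.fst_swap, Prod.snd_swap, ← hb, add_comm]
  exact h l k

theorem Covers.isPositive {x y : (Fin r → ℕ) × (Fin s → ℕ)} (h : Covers x y)
    (hx : IsPositive x) : IsPositive y := by
  obtain ⟨k, l, -, rfl⟩ := h
  exact ⟨fun i h => hx.1 i (by simp at h; omega), fun j h => hx.2 j (by simp at h; omega)⟩

theorem Covers.isBalanced {x y : (Fin r → ℕ) × (Fin s → ℕ)} (h : Covers x y)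
    (hx : IsBalanced x) : IsBalanced y := by
  obtain ⟨k, l, -, rfl⟩ := h
  rw [IsBalanced, sum_add_single, sum_add_single, hx]

theorem Covers.sum_eq {x y : (Fin r → ℕ) × (Fin s → ℕ)} (h : Covers x y) :
    ∑ i, y.1 i = ∑ i, x.1 i + 1 := by
  obtain ⟨k, l, -, rfl⟩ := h
  rw [sum_add_single]

theorem Covers.swap {x y : (Fin r → ℕ) × (Fin s → ℕ)} (h : Covers x y) (hx : IsBalanced x) :
    Covers x.swap y.swap := by
  obtain ⟨k, l, h, rfl⟩ := h
  refine ⟨l, k, ?_, rfl⟩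
  rw [Prod.fst_swap, Prod.snd_swap, ← hx, add_comm]
  exact h

theorem isPositive_isBalanced_of_reflTransGen {x y : (Fin r → ℕ) × (Fin s → ℕ)}
    (h : Relation.ReflTransGen Covers x y) (hx : IsPositive x) (hb : IsBalanced x) :
    IsPositive y ∧ IsBalanced y := by
  induction h with
  | refl => exact ⟨hx, hb⟩
  | tail _ hc ih => exact ⟨hc.isPositive ih.1, hc.isBalanced ih.2⟩

theorem sum_le_of_reflTransGen {x y : (Fin r → ℕ) × (Fin s → ℕ)}
    (h : Relation.ReflTransGen Covers x y) : ∑ i, x.1 i ≤ ∑ i, y.1 i := by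
  induction h with
  | refl => exact le_rfl
  | tail _ hc ih => exact ih.trans (by rw [hc.sum_eq]; omega)

theorem reflTransGen_swap {x y : (Fin r → ℕ) × (Fin s → ℕ)}
    (h : Relation.ReflTransGen Covers x y) (hx : IsPositive x) (hb : IsBalanced x) :
    Relation.ReflTransGen Covers x.swap y.swap := by
  induction h with
  | refl => exact .refl
  | tail h hc ih => exact ih.tail (hc.swap (isPositive_isBalanced_of_reflTransGen h hx hb).2)

/-- A down-step between positive balanced pairs. -/
def DownStep (x y : (Fin r → ℕ) × (Fin s → ℕ)) : Prop :=
  IsBalanced y ∧ IsPositive y ∧ Covers y x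

theorem DownStep.swap {x y : (Fin r → ℕ) × (Fin s → ℕ)} (h : DownStep x y) :
    DownStep x.swap y.swap :=
  ⟨h.1.swap, h.2.1.swap, h.2.2.swap h.1⟩

/-- Two down-steps that decrease the same entry of the first vector commute. -/
theorem exists_common_of_row {x b c : (Fin r → ℕ) × (Fin s → ℕ)} {k : Fin r} {l l' : Fin s}
    (hl : l ≠ l') (hb : IsPositive b) (hc : IsPositive c) (hbal : IsBalanced b)
    (hbk : ∑ i, b.1 i ≤ b.1 k + b.2 l) (hck : ∑ i, c.1 i ≤ c.1 k + c.2 l')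
    (hxb : x = (b.1 + Pi.single k 1, b.2 + Pi.single l 1))
    (hxc : x = (c.1 + Pi.single k 1, c.2 + Pi.single l' 1)) :
    ∃ d, DownStep b d ∧ DownStep c d := by
  have e1 : b.1 = c.1 := by
    have := congrArg Prod.fst (hxb.symm.trans hxc)
    exact add_right_cancel this
  have e2 : b.2 + Pi.single l 1 = c.2 + Pi.single l' 1 := congrArg Prod.snd (hxb.symm.trans hxc)
  have e2l : b.2 l + 1 = c.2 l := by simpa [hl] using congrFun e2 l
  have e2l' : b.2 l' = c.2 l' + 1 := by simpa [hl.symm] using congrFun e2 l'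
  have hs := add_le_sum b.2 hl
  have p1 := Nat.pos_of_ne_zero (hb.2 l)
  have p2 := Nat.pos_of_ne_zero (hc.2 l')
  rw [IsBalanced] at hbal
  rw [← e1] at hck
  -- From `hbk`, `hs` and balance, `b.2 l' ≤ b.1 k`, and `b.2 l' = c.2 l' + 1` is at least two. So
  -- `k` and `l'` can both be lowered once more, which yields the common lower pair.
  have hk : 2 ≤ b.1 k := by omega
  have s1 := sub_single_add b.1 (k := k) (by omega)
  have s2 := sub_single_add b.2 (k := l') (by omega)
  have hbeq : b = ((b.1 - Pi.single k 1) + Pi.single k 1, (b.2 - Pi.single l' 1) + Pi.single l' 1) :=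
    Prod.ext s1.symm s2.symm
  have hceq : c = ((b.1 - Pi.single k 1) + Pi.single k 1,
      (b.2 - Pi.single l' 1) + Pi.single l 1) := by
    refine Prod.ext (e1.symm.trans s1.symm) ?_
    have : c.2 + Pi.single l' 1 = (b.2 - Pi.single l' 1) + Pi.single l 1 + Pi.single l' 1 := by
      rw [add_right_comm, s2, e2]
    exact add_right_cancel this
  have t1 : ∑ i, (b.1 - Pi.single k 1 : Fin r → ℕ) i + 1 = ∑ i, b.1 i := by
    rw [← sum_add_single, s1]
  have t2 : ∑ i, (b.2 - Pi.single l' 1 : Fin s → ℕ) i + 1 = ∑ i, b.2 i := by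
    rw [← sum_add_single, s2]
  have hpos : IsPositive (b.1 - Pi.single k 1, b.2 - Pi.single l' 1) := by
    constructor
    · intro i
      by_cases hi : i = k
      · subst hi; simp; omega
      · simpa [hi] using hb.1 i
    · intro j
      by_cases hj : j = l'
      · subst hj; simp; omega
      · simpa [hj] using hb.2 j
  have hbald : IsBalanced (b.1 - Pi.single k 1, b.2 - Pi.single l' 1) := by
    simp only [IsBalanced]
    omega
  refine ⟨(b.1 - Pi.single k 1, b.2 - Pi.single l' 1), ⟨hbald, hpos, k, l', ?_, hbeq⟩,
    ⟨hbald, hpos, k, l, ?_, hceq⟩⟩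
  · have : (b.1 - Pi.single k 1 : Fin r → ℕ) k + (b.2 - Pi.single l' 1 : Fin s → ℕ) l' =
        b.1 k - 1 + (b.2 l' - 1) := by simp
    dsimp only
    omega
  · have : (b.1 - Pi.single k 1 : Fin r → ℕ) k + (b.2 - Pi.single l' 1 : Fin s → ℕ) l =
        b.1 k - 1 + b.2 l := by
      simp [hl]
    dsimp only
    omega

/-- Down-steps in the same row or column commute by `exists_common_of_row`, and no other two
distinct down-steps leave the same pair. -/
theorem downStep_diamond {x b c : (Fin r → ℕ) × (Fin s → ℕ)} (hb : DownStep x b)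
    (hc : DownStep x c) :
    ∃ d, Relation.ReflGen DownStep b d ∧ Relation.ReflTransGen DownStep c d := by
  obtain ⟨bb, pb, k, l, h1, h2⟩ := id hb
  obtain ⟨bc, pc, k', l', h3, h4⟩ := id hc
  by_cases hk : k = k'
  · subst hk
    by_cases hl : l = l'
    · subst hl
      have : b = c := by
        have := h2.symm.trans h4
        rw [Prod.mk.injEq] at this
        exact Prod.ext (add_right_cancel this.1) (add_right_cancel this.2)
      subst this
      exact ⟨b, .refl, .refl⟩
    · obtain ⟨d, hd, hd'⟩ := exists_common_of_row hl pb pc bb h1 h3 h2 h4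
      exact ⟨d, .single hd, .single hd'⟩
  · by_cases hl : l = l'
    · subst hl
      have h1' : ∑ i, b.swap.1 i ≤ b.swap.1 l + b.swap.2 k := by
        rw [Prod.fst_swap, Prod.snd_swap, ← bb, add_comm]; exact h1
      have h3' : ∑ i, c.swap.1 i ≤ c.swap.1 l + c.swap.2 k' := by
        rw [Prod.fst_swap, Prod.snd_swap, ← bc, add_comm]; exact h3
      obtain ⟨d, hd, hd'⟩ := exists_common_of_row (x := x.swap) hk pb.swap pc.swap
        bb.swap h1' h3' (by rw [h2]; rfl) (by rw [h4]; rfl)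
      exact ⟨d.swap, .single (by simpa using hd.swap), .single (by simpa using hd'.swap)⟩
    -- A down-step at `(k, l)` needs `x.1 k + x.2 l > |x|`. For two positions with distinct rows and
    -- distinct columns the four entries would add up to more than `2|x|`.
    · exfalso
      have hx := hb.2.2.isBalanced bb
      have hx1 := hb.2.2.sum_eq
      have hx2 := hc.2.2.sum_eq
      have e1 : x.1 k = b.1 k + 1 := by simp [h2]
      have e2 : x.2 l = b.2 l + 1 := by simp [h2]
      have e3 : x.1 k' = c.1 k' + 1 := by simp [h4]
      have e4 : x.2 l' = c.2 l' + 1 := by simp [h4]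
      have s1 := add_le_sum x.1 hk
      have s2 := add_le_sum x.2 hl
      rw [IsBalanced] at hx
      omega

theorem reflTransGen_downStep {x y : (Fin r → ℕ) × (Fin s → ℕ)}
    (h : Relation.ReflTransGen Covers x y) (hx : IsPositive x) (hb : IsBalanced x) :
    Relation.ReflTransGen DownStep y x := by
  induction h with
  | refl => exact .refl
  | tail h hc ih =>
    have := isPositive_isBalanced_of_reflTransGen h hx hb
    exact ih.head ⟨this.2, this.1, hc⟩

theorem IsReduced.not_downStep {x y : (Fin r → ℕ) × (Fin s → ℕ)} (h : IsReduced x) :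
    ¬ DownStep x y := by
  rintro ⟨-, -, k, l, h1, h2⟩
  have h3 := h k l
  have e1 : x.1 k = y.1 k + 1 := by simp [h2]
  have e2 : x.2 l = y.2 l + 1 := by simp [h2]
  have e3 : ∑ i, x.1 i = ∑ i, y.1 i + 1 := by rw [h2, sum_add_single]
  omega

/-- The reduction of a pair is unique. -/
theorem reduced_unique {x y w : (Fin r → ℕ) × (Fin s → ℕ)}
    (hx : IsReduced x) (hxp : IsPositive x) (hxb : IsBalanced x)
    (hy : IsReduced y) (hyp : IsPositive y) (hyb : IsBalanced y)
    (hxw : Relation.ReflTransGen Covers x w) (hyw : Relation.ReflTransGen Covers y w) : x = y := by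
  obtain ⟨d, hxd, hyd⟩ := Relation.church_rosser (fun _ _ _ => downStep_diamond)
    (reflTransGen_downStep hxw hxp hxb) (reflTransGen_downStep hyw hyp hyb)
  have key : ∀ {z : (Fin r → ℕ) × (Fin s → ℕ)}, IsReduced z →
      Relation.ReflTransGen DownStep z d → z = d := by
    intro z hz h
    rcases Relation.ReflTransGen.cases_head h with h | ⟨c, hc, -⟩
    · exact h
    · exact absurd hc hz.not_downStep
  rw [key hx hxd, key hy hyd]

/-- If `w.1 k + w.2 l > |w|`, a second positive entry in each vector forces both of these entries to
be at least two, so lowering them keeps the pair positive. -/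
theorem exists_reduced {w : (Fin r → ℕ) × (Fin s → ℕ)} (hr : 2 ≤ r) (hs : 2 ≤ s)
    (hp : IsPositive w) (hb : IsBalanced w) :
    ∃ x, IsReduced x ∧ IsPositive x ∧ IsBalanced x ∧ Relation.ReflTransGen Covers x w := by
  induction hN : ∑ i, w.1 i using Nat.strong_induction_on generalizing w with
  | _ N ih =>
  by_cases hred : IsReduced w
  · exact ⟨w, hred, hp, hb, .refl⟩
  · simp only [IsReduced, not_forall, not_le] at hred
    obtain ⟨k, l, hkl⟩ := hred
    have other : ∀ {t : ℕ}, 2 ≤ t → ∀ i : Fin t, ∃ i', i ≠ i' := by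
      intro t ht i
      have : Nontrivial (Fin t) := Fin.nontrivial_iff_two_le.2 ht
      obtain ⟨i', hi'⟩ := exists_ne i
      exact ⟨i', hi'.symm⟩
    obtain ⟨k', hk'⟩ := other hr k
    obtain ⟨l', hl'⟩ := other hs l
    have a1 := add_le_sum w.1 hk'
    have a2 := add_le_sum w.2 hl'
    have p1 := Nat.pos_of_ne_zero (hp.1 k')
    have p2 := Nat.pos_of_ne_zero (hp.2 l')
    have hb' : ∑ i, w.1 i = ∑ j, w.2 j := hb
    have s1 := sub_single_add w.1 (k := k) (by omega)
    have s2 := sub_single_add w.2 (k := l) (by omega)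
    have t1 : ∑ i, (w.1 - Pi.single k 1 : Fin r → ℕ) i + 1 = ∑ i, w.1 i := by rw [← sum_add_single, s1]
    have t2 : ∑ i, (w.2 - Pi.single l 1 : Fin s → ℕ) i + 1 = ∑ i, w.2 i := by rw [← sum_add_single, s2]
    have hpos : IsPositive (w.1 - Pi.single k 1, w.2 - Pi.single l 1) := by
      constructor
      · intro i
        by_cases hi : i = k
        · subst hi; simp; omega
        · simpa [hi] using hp.1 i
      · intro j
        by_cases hj : j = l
        · subst hj; simp; omega
        · simpa [hj] using hp.2 j
    have hbal : IsBalanced (w.1 - Pi.single k 1, w.2 - Pi.single l 1) := by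
      simp only [IsBalanced]
      omega
    obtain ⟨x, h1, h2, h3, h4⟩ :=
      ih (∑ i, (w.1 - Pi.single k 1 : Fin r → ℕ) i) (by omega) hpos hbal rfl
    refine ⟨x, h1, h2, h3, h4.tail ⟨k, l, ?_, Prod.ext s1.symm s2.symm⟩⟩
    have : (w.1 - Pi.single k 1 : Fin r → ℕ) k + (w.2 - Pi.single l 1 : Fin s → ℕ) l =
        w.1 k - 1 + (w.2 l - 1) := by simp
    dsimp only
    omega

/-! ### Counting the pairs above a reduced pair -/

/-- The pairs of degree `d` above `x`. -/
def aboveSet (x : (Fin r → ℕ) × (Fin s → ℕ)) (d : ℕ) : Set ((Fin r → ℕ) × (Fin s → ℕ)) :=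
  {y | (∑ i, y.1 i = d ∧ ∑ j, y.2 j = d) ∧ ((∀ i, y.1 i ≠ 0) ∧ ∀ j, y.2 j ≠ 0) ∧
    Relation.ReflTransGen Covers x y}

theorem mem_aboveSet {x y : (Fin r → ℕ) × (Fin s → ℕ)} {d : ℕ} (hp : IsPositive x)
    (hb : IsBalanced x) :
    y ∈ aboveSet x d ↔ Relation.ReflTransGen Covers x y ∧ ∑ i, y.1 i = d := by
  constructor
  · rintro ⟨⟨h1, -⟩, -, h⟩
    exact ⟨h, h1⟩
  · rintro ⟨h, h1⟩
    have h2 := isPositive_isBalanced_of_reflTransGen h hp hb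
    exact ⟨⟨h1, h2.2.symm.trans h1⟩, h2.1, h⟩

theorem ncard_aboveSet_swap (x : (Fin r → ℕ) × (Fin s → ℕ)) (d : ℕ) (hp : IsPositive x)
    (hb : IsBalanced x) : (aboveSet x.swap d).ncard = (aboveSet x d).ncard := by
  have : aboveSet x.swap d = Prod.swap '' aboveSet x d := by
    ext y
    rw [mem_aboveSet hp.swap hb.swap, Set.mem_image]
    constructor
    · rintro ⟨h, h'⟩
      have h2 := isPositive_isBalanced_of_reflTransGen h hp.swap hb.swap
      refine ⟨y.swap, (mem_aboveSet hp hb).2 ⟨?_, h2.2.symm.trans h'⟩, by simp⟩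
      simpa using reflTransGen_swap h hp.swap hb.swap
    · rintro ⟨z, hz, rfl⟩
      obtain ⟨h, h'⟩ := (mem_aboveSet hp hb).1 hz
      have h2 := isPositive_isBalanced_of_reflTransGen h hp hb
      exact ⟨reflTransGen_swap h hp hb, h2.2.symm.trans h'⟩
  rw [this, Set.ncard_image_of_injective _ Prod.swap_injective]

theorem card_piAntidiag {ι : Type*} [DecidableEq ι] (L : Finset ι) (N : ℕ) :
    (L.piAntidiag N).card = (L.card + N - 1).choose N := by
  rw [← Finset.card_finsuppAntidiag_nat_eq_choose, Finset.finsuppAntidiag, Finset.card_map,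
    Finset.card_attach]

/-- If all growth positions lie in row `k₀`, they stay the only positions where a step is possible,
and each of them can be used any number of times. A pair above `x` is thus a distribution of `N`
units over the columns in `L`. -/
theorem ncard_aboveSet_of_row {x : (Fin r → ℕ) × (Fin s → ℕ)} {d : ℕ} (hp : IsPositive x)
    (hb : IsBalanced x) (hred : IsReduced x) (hd : ∑ i, x.1 i ≤ d) (k₀ : Fin r)
    (hk₀ : ∀ k l, x.1 k + x.2 l = ∑ i, x.1 i → k = k₀) :
    (aboveSet x d).ncard =
      ((Finset.univ.filter fun l => x.1 k₀ + x.2 l = ∑ i, x.1 i).card + (d - ∑ i, x.1 i) - 1).choose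
        (d - ∑ i, x.1 i) := by
  set L := Finset.univ.filter fun l => x.1 k₀ + x.2 l = ∑ i, x.1 i with hL
  set N := d - ∑ i, x.1 i with hN
  have forward : ∀ y, Relation.ReflTransGen Covers x y → ∃ c : Fin s → ℕ, (∀ l, c l ≠ 0 → l ∈ L) ∧
      y = (x.1 + Pi.single k₀ (∑ l, c l), x.2 + c) := by
    intro y hy
    induction hy with
    | refl => exact ⟨0, by simp, by simp⟩
    | tail _ hc ih =>
      obtain ⟨c, hcL, rfl⟩ := ih
      obtain ⟨k, l, h, rfl⟩ := hc
      rw [sum_add_single] at h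
      have h1 := hred k l
      have hcl := le_sum c l
      -- The degree has grown by `∑ c`. Outside row `k₀` the position has gained only `c l ≤ ∑ c`,
      -- so a legal step there would already be a growth position of `x`. In row `k₀` the position
      -- has gained `∑ c + c l`, so an unused column must be tight in `x`.
      have hkl : k = k₀ ∧ l ∈ L := by
        by_cases hk : k = k₀
        · subst hk
          simp only [Pi.add_apply, Pi.single_eq_same] at h
          refine ⟨rfl, ?_⟩
          by_cases hc0 : c l = 0
          · rw [hL, Finset.mem_filter]
            exact ⟨Finset.mem_univ _, by omega⟩
          · exact hcL l hc0
        · simp only [Pi.add_apply, Pi.single_eq_of_ne hk] at h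
          exact absurd (hk₀ k l (by omega)) hk
      obtain ⟨rfl, hl⟩ := hkl
      refine ⟨c + Pi.single l 1, fun j hj => ?_, ?_⟩
      · by_cases hjl : j = l
        · exact hjl ▸ hl
        · exact hcL j (by simpa [hjl] using hj)
      · rw [sum_add_single, Pi.single_add, add_assoc, add_assoc]
  have backward : ∀ M, ∀ c : Fin s → ℕ, (∀ l, c l ≠ 0 → l ∈ L) → ∑ l, c l = M →
      Relation.ReflTransGen Covers x (x.1 + Pi.single k₀ M, x.2 + c) := by
    intro M
    induction M with
    | zero =>
      intro c _ hc
      have : c = 0 := by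
        ext l
        have := le_sum c l
        simpa [hc] using this
      subst this
      simp only [Pi.single_zero, add_zero]
      exact .refl
    | succ M ih =>
      intro c hcL hc
      obtain ⟨l, hl⟩ : ∃ l, c l ≠ 0 := by
        by_contra h
        push Not at h
        simp [h] at hc
      have s1 := sub_single_add c hl
      have t1 : ∑ i, (c - Pi.single l 1 : Fin s → ℕ) i + 1 = ∑ i, c i := by rw [← sum_add_single, s1]
      have hstep := ih (c - Pi.single l 1) (fun j hj => hcL j fun h0 => hj (by simp [h0])) (by omega)
      refine hstep.tail ⟨k₀, l, ?_, ?_⟩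
      · rw [sum_add_single]
        have := (Finset.mem_filter.1 (hcL l hl)).2
        simp only [Pi.add_apply, Pi.single_eq_same]
        omega
      · rw [add_assoc, add_assoc, s1, ← Pi.single_add]
  have himage : aboveSet x d = (fun c : Fin s → ℕ => (x.1 + Pi.single k₀ N, x.2 + c)) ''
      (Finset.piAntidiag L N : Set (Fin s → ℕ)) := by
    ext y
    rw [mem_aboveSet hp hb, Set.mem_image]
    constructor
    · rintro ⟨h, h'⟩
      obtain ⟨c, hc, rfl⟩ := forward y h
      rw [sum_add_single] at h'
      have hcN : ∑ l, c l = N := by omega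
      refine ⟨c, ?_, by rw [hcN]⟩
      rw [Finset.mem_coe, Finset.mem_piAntidiag]
      refine ⟨?_, hc⟩
      rw [← hcN]
      exact Finset.sum_subset (Finset.subset_univ _) fun l _ hl => by
        by_contra h0
        exact hl (hc l h0)
    · rintro ⟨c, hc, rfl⟩
      rw [Finset.mem_coe, Finset.mem_piAntidiag] at hc
      refine ⟨backward N c hc.2 ?_, by rw [sum_add_single]; omega⟩
      rw [← hc.1]
      exact (Finset.sum_subset (Finset.subset_univ _) fun l _ hl => by
        by_contra h0
        exact hl (hc.2 l h0)).symm
  rw [himage, Set.ncard_image_of_injective, Set.ncard_coe_finset,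
    card_piAntidiag]
  intro c c' h
  exact add_left_cancel (congrArg Prod.snd h)

/-- The growth potential of a pair of vectors. -/
def growth (x : (Fin r → ℕ) × (Fin s → ℕ)) : ℕ :=
  (Finset.univ.filter fun z : Fin r × Fin s => x.1 z.1 + x.2 z.2 = ∑ i, x.1 i).card

theorem growth_swap (x : (Fin r → ℕ) × (Fin s → ℕ)) (hb : IsBalanced x) :
    growth x.swap = growth x := by
  rw [growth, growth]
  refine Finset.card_bij (fun z _ => z.swap) ?_ ?_ ?_
  · intro z hz
    simp only [Finset.mem_filter, Finset.mem_univ, true_and, Prod.fst_swap, Prod.snd_swap] at hz ⊢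
    rw [IsBalanced] at hb
    omega
  · intro a _ b _ h
    exact Prod.swap_injective h
  · intro z hz
    refine ⟨z.swap, ?_, by simp⟩
    simp only [Finset.mem_filter, Finset.mem_univ, true_and, Prod.fst_swap, Prod.snd_swap] at hz ⊢
    rw [IsBalanced] at hb
    omega

theorem growth_of_row {x : (Fin r → ℕ) × (Fin s → ℕ)} (k₀ : Fin r)
    (hk₀ : ∀ k l, x.1 k + x.2 l = ∑ i, x.1 i → k = k₀) :
    (Finset.univ.filter fun l => x.1 k₀ + x.2 l = ∑ i, x.1 i).card = growth x := by
  refine Finset.card_bij (fun l _ => (k₀, l)) ?_ ?_ ?_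
  · intro l hl
    simpa using hl
  · intro a _ b _ h
    exact congrArg Prod.snd h
  · rintro ⟨k, l⟩ hz
    simp only [Finset.mem_filter, Finset.mem_univ, true_and] at hz
    obtain rfl := hk₀ k l hz
    exact ⟨l, by simpa using hz, rfl⟩

/-- For `g = 0` truncated subtraction makes the left side one at `N = 0` and zero otherwise, which
is the Kronecker delta of the statement. -/
theorem choose_growth (g N : ℕ) : (g + N - 1).choose N =
    if 1 ≤ g then (N + (g - 1)).choose (g - 1) else if N = 0 then 1 else 0 := by
  rcases g with _ | g
  · rcases N with _ | N
    · simp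
    · simp
  · rw [if_pos (by omega), Nat.add_sub_cancel, show g + 1 + N - 1 = N + g by omega]
    exact Nat.choose_symm_add

theorem ncard_aboveSet {x : (Fin r → ℕ) × (Fin s → ℕ)} {d : ℕ} (hp : IsPositive x)
    (hb : IsBalanced x) (hred : IsReduced x) (hd : ∑ i, x.1 i ≤ d) (hs : 3 ≤ s) :
    (aboveSet x d).ncard = if 1 ≤ growth x then
      ((d - ∑ i, x.1 i) + (growth x - 1)).choose (growth x - 1)
      else if d = ∑ i, x.1 i then 1 else 0 := by
  have hb' : ∑ i, x.1 i = ∑ j, x.2 j := hb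
  -- Two growth positions in distinct rows and columns would exhaust both vectors, leaving nothing
  -- for a third positive entry of the second one.
  have share : ∀ k l k' l', x.1 k + x.2 l = ∑ i, x.1 i → x.1 k' + x.2 l' = ∑ i, x.1 i →
      k = k' ∨ l = l' := by
    intro k l k' l' h h'
    by_contra hne
    push Not at hne
    have a1 := add_le_sum x.1 hne.1
    obtain ⟨j, hj⟩ : ∃ j, j ∉ ({l, l'} : Finset (Fin s)) := by
      by_contra hall
      push Not at hall
      have h1 : (Finset.univ : Finset (Fin s)) ⊆ {l, l'} := fun j _ => hall j
      have h2 := (Finset.card_le_card h1).trans Finset.card_le_two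
      simp at h2
      omega
    have h3 : ∑ i ∈ insert j {l, l'}, x.2 i ≤ ∑ i, x.2 i :=
      Finset.sum_le_sum_of_subset (Finset.subset_univ _)
    rw [Finset.sum_insert hj, Finset.sum_pair hne.2] at h3
    have := Nat.pos_of_ne_zero (hp.2 j)
    omega
  have hr : 0 < r := by
    rcases Nat.eq_zero_or_pos r with rfl | h
    · have := le_sum x.2 ⟨0, by omega⟩
      rw [← hb', Fin.sum_univ_zero] at this
      exact absurd (Nat.le_zero.1 this) (hp.2 _)
    · exact h
  -- Positions that pairwise share a row or a column all lie on one line.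
  have hline : (∃ k₀, ∀ k l, x.1 k + x.2 l = ∑ i, x.1 i → k = k₀) ∨
      ∃ l₀, ∀ k l, x.1 k + x.2 l = ∑ i, x.1 i → l = l₀ := by
    by_cases hG : ∃ k l, x.1 k + x.2 l = ∑ i, x.1 i
    · obtain ⟨k₁, l₁, h₁⟩ := hG
      by_contra hne
      push Not at hne
      obtain ⟨k₂, l₂, h₂, hk₂⟩ := hne.1 k₁
      obtain ⟨k₃, l₃, h₃, hl₃⟩ := hne.2 l₁
      have e₁ := (share _ _ _ _ h₂ h₁).resolve_left hk₂
      have e₂ := (share _ _ _ _ h₃ h₁).resolve_right hl₃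
      rcases share _ _ _ _ h₂ h₃ with h | h
      · exact hk₂ (h.trans e₂)
      · exact hl₃ (h.symm.trans e₁)
    · push Not at hG
      -- Without growth positions any row serves.
      exact Or.inl ⟨⟨0, hr⟩, fun k l h => absurd h (hG k l)⟩
  have hδ : (d = ∑ i, x.1 i) ↔ (d - ∑ i, x.1 i = 0) := by omega
  simp only [hδ]
  rw [← choose_growth]
  rcases hline with ⟨k₀, hk₀⟩ | ⟨l₀, hl₀⟩
  · rw [ncard_aboveSet_of_row hp hb hred hd k₀ hk₀, growth_of_row k₀ hk₀]
  · have hl₀' : ∀ k l, x.swap.1 k + x.swap.2 l = ∑ i, x.swap.1 i → k = l₀ := fun k l h => by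
      rw [Prod.fst_swap, Prod.snd_swap, ← hb', add_comm] at h
      exact hl₀ l k h
    rw [← ncard_aboveSet_swap x d hp hb, ncard_aboveSet_of_row (x := x.swap) hp.swap hb.swap (hred.swap hb)
      (by rw [Prod.fst_swap, ← hb']; exact hd) l₀ hl₀', growth_of_row l₀ hl₀', growth_swap x hb,
      Prod.fst_swap, ← hb']

/-- A pair of vectors of length two. -/
def square (i i' j j' : ℕ) : (Fin 2 → ℕ) × (Fin 2 → ℕ) := (![i, i'], ![j, j'])

theorem covers_square {i i' j j' : ℕ} :
    (i + i' ≤ i + j → Covers (square i i' j j') (square (i + 1) i' (j + 1) j')) ∧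
    (i + i' ≤ i + j' → Covers (square i i' j j') (square (i + 1) i' j (j' + 1))) ∧
    (i + i' ≤ i' + j → Covers (square i i' j j') (square i (i' + 1) (j + 1) j')) ∧
    (i + i' ≤ i' + j' → Covers (square i i' j j') (square i (i' + 1) j (j' + 1))) := by
  refine ⟨fun h => ⟨0, 0, ?_, ?_⟩, fun h => ⟨0, 1, ?_, ?_⟩, fun h => ⟨1, 0, ?_, ?_⟩,
    fun h => ⟨1, 1, ?_, ?_⟩⟩
  all_goals first
    | simpa [square] using h
    | (refine Prod.ext ?_ ?_ <;> ext a <;> fin_cases a <;> simp [square])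

theorem reflTransGen_square (t : ℕ) (N : ℕ) {i i' j j' : ℕ} (h : i + i' = N) (h' : j + j' = N)
    (hb : i = 0 ∨ i' = 0 ∨ j = 0 ∨ j' = 0) :
    Relation.ReflTransGen Covers (square t t t t) (square (t + i) (t + i') (t + j) (t + j')) := by
  induction N generalizing i i' j j' with
  | zero =>
    obtain ⟨rfl, rfl⟩ : i = 0 ∧ i' = 0 := by omega
    obtain ⟨rfl, rfl⟩ : j = 0 ∧ j' = 0 := by omega
    exact .refl
  | succ N ih =>
    -- A last step is undone so that one of the four excesses is still zero. The step raising `a`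
    -- and `b` is legal exactly when the other excess of the first vector is at most `b`.
    have key : (∃ a b, i = a + 1 ∧ j = b + 1 ∧ (a = 0 ∨ i' = 0 ∨ b = 0 ∨ j' = 0) ∧ i' ≤ b ∧ j' ≤ a) ∨
        (∃ a b, i = a + 1 ∧ j' = b + 1 ∧ (a = 0 ∨ i' = 0 ∨ j = 0 ∨ b = 0) ∧ i' ≤ b ∧ j ≤ a) ∨
        (∃ a b, i' = a + 1 ∧ j = b + 1 ∧ (i = 0 ∨ a = 0 ∨ b = 0 ∨ j' = 0) ∧ i ≤ b ∧ j' ≤ a) ∨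
        (∃ a b, i' = a + 1 ∧ j' = b + 1 ∧ (i = 0 ∨ a = 0 ∨ j = 0 ∨ b = 0) ∧ i ≤ b ∧ j ≤ a) := by
      rcases i with _ | i <;> rcases i' with _ | i' <;> rcases j with _ | j <;>
        rcases j' with _ | j' <;> simp <;> omega
    rcases key with ⟨a, b, rfl, rfl, hb', h1, h2⟩ | ⟨a, b, rfl, rfl, hb', h1, h2⟩ |
      ⟨a, b, rfl, rfl, hb', h1, h2⟩ | ⟨a, b, rfl, rfl, hb', h1, h2⟩
    · exact (ih (by omega) (by omega) hb').tail (covers_square.1 (by omega))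
    · exact (ih (by omega) (by omega) hb').tail (covers_square.2.1 (by omega))
    · exact (ih (by omega) (by omega) hb').tail (covers_square.2.2.1 (by omega))
    · exact (ih (by omega) (by omega) hb').tail (covers_square.2.2.2 (by omega))

/-- A step raising `i` and `j` is legal only if `i' ≤ j`, equivalently `j' ≤ i`. If the zero excess
was `i` or `j`, then `j'` or `i'` vanishes too, so a zero survives the step. -/
theorem exists_square_of_reflTransGen (t : ℕ) {y : (Fin 2 → ℕ) × (Fin 2 → ℕ)}
    (h : Relation.ReflTransGen Covers (square t t t t) y) :
    ∃ i i' j j', y = square (t + i) (t + i') (t + j) (t + j') ∧ i + i' = j + j' ∧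
      (i = 0 ∨ i' = 0 ∨ j = 0 ∨ j' = 0) := by
  induction h with
  | refl => exact ⟨0, 0, 0, 0, rfl, rfl, Or.inl rfl⟩
  | tail _ hc ih =>
    obtain ⟨i, i', j, j', rfl, h1, h2⟩ := ih
    obtain ⟨k, l, h, rfl⟩ := hc
    rw [Fin.sum_univ_two] at h
    fin_cases k <;> fin_cases l <;> simp [square] at h
    · refine ⟨i + 1, i', j + 1, j', ?_, by omega, by omega⟩
      refine Prod.ext ?_ ?_ <;> ext a <;> fin_cases a <;> simp [square, add_assoc]
    · refine ⟨i + 1, i', j, j' + 1, ?_, by omega, by omega⟩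
      refine Prod.ext ?_ ?_ <;> ext a <;> fin_cases a <;> simp [square, add_assoc]
    · refine ⟨i, i' + 1, j + 1, j', ?_, by omega, by omega⟩
      refine Prod.ext ?_ ?_ <;> ext a <;> fin_cases a <;> simp [square, add_assoc]
    · refine ⟨i, i' + 1, j, j' + 1, ?_, by omega, by omega⟩
      refine Prod.ext ?_ ?_ <;> ext a <;> fin_cases a <;> simp [square, add_assoc]

theorem card_boundary (N : ℕ) :
    (((Finset.range (N + 1)) ×ˢ (Finset.range (N + 1))).filter fun z : ℕ × ℕ =>
      z.1 = 0 ∨ z.1 = N ∨ z.2 = 0 ∨ z.2 = N).card = 4 * N + if N = 0 then 1 else 0 := by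
  rcases N with _ | N
  · rfl
  -- The boundary is the full grid minus its interior, with `(N + 2)² - N²` points.
  · have h : (((Finset.range (N + 2)) ×ˢ (Finset.range (N + 2))).filter fun z : ℕ × ℕ =>
        z.1 = 0 ∨ z.1 = N + 1 ∨ z.2 = 0 ∨ z.2 = N + 1) =
        ((Finset.range (N + 2)) ×ˢ (Finset.range (N + 2))) \
          ((Finset.Ioo 0 (N + 1)) ×ˢ (Finset.Ioo 0 (N + 1))) := by
      ext z
      simp only [Finset.mem_filter, Finset.mem_product, Finset.mem_range, Finset.mem_sdiff,
        Finset.mem_Ioo]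
      omega
    rw [h, Finset.card_sdiff_of_subset]
    · simp only [Finset.card_product, Finset.card_range, Nat.card_Ioo]
      have : (N + 2) * (N + 2) = N * N + 4 * (N + 1) := by ring
      simp [this]
    · intro z
      simp only [Finset.mem_product, Finset.mem_range, Finset.mem_Ioo]
      omega

theorem ncard_aboveSet_two {x : (Fin 2 → ℕ) × (Fin 2 → ℕ)} {d : ℕ} (hp : IsPositive x)
    (hb : IsBalanced x) (hred : IsReduced x) (hd : ∑ i, x.1 i ≤ d) :
    (aboveSet x d).ncard = 4 * (d - ∑ i, x.1 i) + if d = ∑ i, x.1 i then 1 else 0 := by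
  -- Reducedness bounds each entry of the second vector by each entry of the first, and balance
  -- turns these bounds into equalities.
  obtain ⟨t, rfl⟩ : ∃ t, x = square t t t t := by
    refine ⟨x.1 0, ?_⟩
    have h1 := hred 0 0
    have h2 := hred 0 1
    have h3 := hred 1 0
    have h4 := hred 1 1
    rw [IsBalanced] at hb
    rw [Fin.sum_univ_two] at *
    rw [Fin.sum_univ_two] at *
    refine Prod.ext ?_ ?_ <;> ext a <;> fin_cases a <;> simp [square] <;> omega
  have hsum : ∑ i, (square t t t t).1 i = 2 * t := by
    rw [Fin.sum_univ_two]
    simp [square]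
    omega
  rw [hsum] at hd ⊢
  set N := d - 2 * t with hN
  have hδ : (d = 2 * t) ↔ (N = 0) := by omega
  simp only [hδ]
  rw [← card_boundary, ← Set.ncard_coe_finset]
  have himage : aboveSet (square t t t t) d =
      (fun z : ℕ × ℕ => square (t + z.1) (t + (N - z.1)) (t + z.2) (t + (N - z.2))) ''
      ((((Finset.range (N + 1)) ×ˢ (Finset.range (N + 1))).filter fun z : ℕ × ℕ =>
      z.1 = 0 ∨ z.1 = N ∨ z.2 = 0 ∨ z.2 = N : Finset (ℕ × ℕ)) : Set (ℕ × ℕ)) := by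
    ext y
    rw [mem_aboveSet hp hb, Set.mem_image]
    constructor
    · rintro ⟨h, h'⟩
      obtain ⟨i, i', j, j', rfl, h1, h2⟩ := exists_square_of_reflTransGen t h
      have h3 : (t + i) + (t + i') = d := by
        rw [Fin.sum_univ_two] at h'
        simpa [square] using h'
      refine ⟨(i, j), ?_, ?_⟩
      · simp only [Finset.coe_filter, Finset.mem_product, Finset.mem_range, Set.mem_ofPred_eq]
        omega
      · dsimp only
        congr 2 <;> omega
    · rintro ⟨⟨i, j⟩, hz, rfl⟩
      simp only [Finset.coe_filter, Finset.mem_product, Finset.mem_range, Set.mem_ofPred_eq] at hz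
      refine ⟨reflTransGen_square t N (by dsimp only; omega) (by dsimp only; omega)
        (by dsimp only; omega), ?_⟩
      rw [Fin.sum_univ_two]
      simp [square]
      omega
  rw [himage, Set.ncard_image_of_injective]
  rintro ⟨i, j⟩ ⟨i', j'⟩ h
  have h1 := congrFun (congrArg Prod.fst h) 0
  have h2 := congrFun (congrArg Prod.snd h) 0
  simp [square] at h1 h2
  rw [h1, h2]

end BlockRSK

/-! ### Isomorphic blocks, classification of the weights and their number -/

namespace BlockRSK

variable {m n r s m' n' m'' n'' : ℕ}

/-! ### Isomorphic blocks -/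

theorem cont_iff {x : (Fin m → ℕ) × (Fin n → ℕ)} {α : Fin m × Fin n →₀ ℕ} :
    ((∀ i, ∑ j, α (i, j) = x.1 i) ∧ ∀ j, ∑ i, α (i, j) = x.2 j) ↔ margins α = x := by
  rw [Prod.ext_iff, funext_iff, funext_iff]
  rfl

/-- The blocks of two weights agree up to a simultaneous reordering of rows and columns. -/
def BlockIso (x : (Fin m → ℕ) × (Fin n → ℕ)) (y : (Fin m' → ℕ) × (Fin n' → ℕ)) : Prop :=
  ∃ e : Cont x.1 x.2 ≃ Cont y.1 y.2, ∀ β α, entry (e β).1 (e α).1 = entry β.1 α.1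

theorem BlockIso.refl (x : (Fin m → ℕ) × (Fin n → ℕ)) : BlockIso x x :=
  ⟨Equiv.refl _, fun _ _ => rfl⟩

theorem BlockIso.trans {x : (Fin m → ℕ) × (Fin n → ℕ)} {y : (Fin m' → ℕ) × (Fin n' → ℕ)}
    {z : (Fin m'' → ℕ) × (Fin n'' → ℕ)} (h : BlockIso x y) (h' : BlockIso y z) : BlockIso x z := by
  obtain ⟨e, he⟩ := h
  obtain ⟨e', he'⟩ := h'
  exact ⟨e.trans e', fun β α => (he' _ _).trans (he _ _)⟩

theorem blockIso_swap (x : (Fin m → ℕ) × (Fin n → ℕ)) : BlockIso x x.swap := by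
  refine ⟨(Finsupp.domCongr (Equiv.prodComm _ _)).toEquiv.subtypeEquiv fun α => ?_, fun β α => ?_⟩
  · simp [and_comm]
  · exact entry_swap (fun x => by simp [Equiv.subtypeEquiv]) (fun x => by simp [Equiv.subtypeEquiv])

theorem sum_eq_of_margins {x : (Fin m → ℕ) × (Fin n → ℕ)} {α : Fin m × Fin n →₀ ℕ}
    (h : margins α = x) : ∑ z, α z = ∑ i, x.1 i := by
  rw [← h, Fintype.sum_prod_type]
  rfl

theorem margins_add (α β : Fin m × Fin n →₀ ℕ) : margins (α + β) = margins α + margins β := by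
  refine Prod.ext ?_ ?_ <;> ext i <;> simp [margins, Finset.sum_add_distrib]

theorem margins_single (z : Fin m × Fin n) :
    margins (Finsupp.single z 1) = (Pi.single z.1 1, Pi.single z.2 1) := by
  rw [← sum_smul_letterWeight]
  simp [Finsupp.single_apply, letterWeight, ite_smul]

/-- Adding one at position `(k, l)` is a bijection between the two sets of tables, compatible with
the entries by `entry_add_single`. -/
theorem blockIso_of_covers {x y : (Fin m → ℕ) × (Fin n → ℕ)} (h : Covers x y) : BlockIso x y := by
  obtain ⟨k, l, h, rfl⟩ := h
  set z : Fin m × Fin n := (k, l) with hz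
  have hadd : ∀ α : Fin m × Fin n →₀ ℕ, margins α = x →
      margins (α + Finsupp.single z 1) = (x.1 + Pi.single k 1, x.2 + Pi.single l 1) := by
    intro α hα
    rw [margins_add, margins_single, hα]
    rfl
  let f : Cont x.1 x.2 → Cont (x.1 + Pi.single k 1) (x.2 + Pi.single l 1) := fun α =>
    ⟨α.1 + Finsupp.single z 1, (cont_iff (x := (x.1 + Pi.single k 1, x.2 + Pi.single l 1))).2
      (hadd α.1 (cont_iff.1 α.2))⟩
  refine ⟨Equiv.ofBijective f ⟨?_, ?_⟩, fun β α => ?_⟩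
  · intro α β hαβ
    exact Subtype.ext (add_right_cancel (congrArg Subtype.val hαβ))
  · rintro ⟨β, hβ⟩
    have hβ' := (cont_iff (x := (x.1 + Pi.single k 1, x.2 + Pi.single l 1))).1 hβ
    have h1 := outside_biword β z
    have h2 := sum_eq_of_margins hβ'
    dsimp only at h2
    rw [sum_add_single] at h2
    have h3 : ∑ j, β (z.1, j) = x.1 k + 1 := by
      rw [hβ.1]; simp [hz]
    have h4 : ∑ i, β (i, z.2) = x.2 l + 1 := by
      rw [hβ.2]; simp [hz]
    -- The row and column sums through `z` together exceed the total, so their overlap cannot be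
    -- zero.
    have h5 : β z ≠ 0 := by omega
    have h6 : β - Finsupp.single z 1 + Finsupp.single z 1 = β := by
      refine tsub_add_cancel_of_le ?_
      rw [Finsupp.single_le_iff]
      omega
    refine ⟨⟨β - Finsupp.single z 1, cont_iff.2 ?_⟩, Subtype.ext h6⟩
    have h7 : margins (β - Finsupp.single z 1) + (Pi.single k 1, Pi.single l 1) =
        x + (Pi.single k 1, Pi.single l 1) := by
      have := margins_add (β - Finsupp.single z 1) (Finsupp.single z 1)
      rw [h6, margins_single] at this
      exact this.symm.trans hβ'
    exact add_right_cancel h7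
  · refine entry_add_single ?_
    rw [sum_eq_of_margins (cont_iff.1 α.2), α.2.1, α.2.2]
    exact h

theorem blockIso_of_reflTransGen {x y : (Fin m → ℕ) × (Fin n → ℕ)}
    (h : Relation.ReflTransGen Covers x y) : BlockIso x y := by
  induction h with
  | refl => exact .refl _
  | tail _ hc ih => exact ih.trans (blockIso_of_covers hc)

/-- Insertion of zero entries. -/
noncomputable def extendPair (f : Fin r ↪o Fin m) (g : Fin s ↪o Fin n)
    (y : (Fin r → ℕ) × (Fin s → ℕ)) : (Fin m → ℕ) × (Fin n → ℕ) :=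
  (Function.extend f y.1 0, Function.extend g y.2 0)

theorem extendPair_injective (f : Fin r ↪o Fin m) (g : Fin s ↪o Fin n) :
    Function.Injective (extendPair f g) := by
  intro y y' h
  refine Prod.ext ?_ ?_
  · exact Function.extend_injective f.injective 0 (congrArg Prod.fst h)
  · exact Function.extend_injective g.injective 0 (congrArg Prod.snd h)

theorem margins_mapDomain (f : Fin r ↪o Fin m) (g : Fin s ↪o Fin n) (α : Fin r × Fin s →₀ ℕ) :
    margins (α.mapDomain (Prod.map f g)) = extendPair f g (margins α) := by
  have hinj : Function.Injective (Prod.map f g) := f.injective.prodMap g.injective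
  refine Prod.ext ?_ ?_
  · ext i
    by_cases hi : ∃ i', f i' = i
    · obtain ⟨i, rfl⟩ := hi
      simp only [extendPair, f.injective.extend_apply, margins]
      refine (Fintype.sum_of_injective g g.injective _ _ (fun j hj => ?_) fun j => ?_).symm
      · refine Finsupp.mapDomain_of_notMem_range _ _ ?_
        rintro ⟨z, hz⟩
        exact hj ⟨z.2, congrArg Prod.snd hz⟩
      · exact (Finsupp.mapDomain_apply hinj α (i, j)).symm
    · simp only [extendPair, Function.extend_apply' _ _ _ hi, margins]
      refine Finset.sum_eq_zero fun j _ => Finsupp.mapDomain_of_notMem_range _ _ ?_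
      rintro ⟨z, hz⟩
      exact hi ⟨z.1, congrArg Prod.fst hz⟩
  · ext j
    by_cases hj : ∃ j', g j' = j
    · obtain ⟨j, rfl⟩ := hj
      simp only [extendPair, g.injective.extend_apply, margins]
      refine (Fintype.sum_of_injective f f.injective _ _ (fun i hi => ?_) fun i => ?_).symm
      · refine Finsupp.mapDomain_of_notMem_range _ _ ?_
        rintro ⟨z, hz⟩
        exact hi ⟨z.1, congrArg Prod.fst hz⟩
      · exact (Finsupp.mapDomain_apply hinj α (i, j)).symm
    · simp only [extendPair, Function.extend_apply' _ _ _ hj, margins]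
      refine Finset.sum_eq_zero fun i _ => Finsupp.mapDomain_of_notMem_range _ _ ?_
      rintro ⟨z, hz⟩
      exact hj ⟨z.2, congrArg Prod.snd hz⟩

theorem blockIso_extendPair (f : Fin r ↪o Fin m) (g : Fin s ↪o Fin n)
    (y : (Fin r → ℕ) × (Fin s → ℕ)) : BlockIso y (extendPair f g y) := by
  have hinj : Function.Injective (Prod.map f g) := f.injective.prodMap g.injective
  let F : Cont y.1 y.2 → Cont (extendPair f g y).1 (extendPair f g y).2 := fun α =>
    ⟨α.1.mapDomain (Prod.map f g), cont_iff.2 (by rw [margins_mapDomain, cont_iff.1 α.2])⟩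
  refine ⟨Equiv.ofBijective F ⟨?_, ?_⟩, fun β α =>
    entry_mapDomain f.strictMono g.strictMono _ _⟩
  · intro α β h
    exact Subtype.ext (Finsupp.mapDomain_injective hinj (congrArg Subtype.val h))
  · rintro ⟨β, hβ⟩
    have hsupp : ∀ z ∈ β.support, z ∈ Set.range (Prod.map f g) := by
      rintro ⟨i, j⟩ hz
      rw [Finsupp.mem_support_iff] at hz
      have h1 : ∃ i', f i' = i := by
        by_contra hi
        have : ∑ j, β (i, j) = Function.extend f y.1 0 i := hβ.1 i
        rw [Function.extend_apply' _ _ _ hi, Pi.zero_apply,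
          Finset.sum_eq_zero_iff] at this
        exact hz (this j (Finset.mem_univ _))
      have h2 : ∃ j', g j' = j := by
        by_contra hj
        have : ∑ i, β (i, j) = Function.extend g y.2 0 j := hβ.2 j
        rw [Function.extend_apply' _ _ _ hj, Pi.zero_apply,
          Finset.sum_eq_zero_iff] at this
        exact hz (this i (Finset.mem_univ _))
      obtain ⟨i', rfl⟩ := h1
      obtain ⟨j', rfl⟩ := h2
      exact ⟨(i', j'), rfl⟩
    have hmap := Finsupp.mapDomain_comapDomain (Prod.map f g) hinj β hsupp
    refine ⟨⟨β.comapDomain (Prod.map f g) hinj.injOn, cont_iff.2 ?_⟩, Subtype.ext hmap⟩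
    refine extendPair_injective f g ?_
    rw [← margins_mapDomain, hmap]
    exact cont_iff.1 hβ

/-! ### Blocks of size one -/

/-- The block of `x` is the identity matrix of size one. -/
def IsUnitBlock (x : (Fin m → ℕ) × (Fin n → ℕ)) : Prop :=
  ∃ a : Cont x.1 x.2, (∀ b, b = a) ∧ entry a.1 a.1 = 1

theorem IsUnitBlock.of_iso {x : (Fin m → ℕ) × (Fin n → ℕ)} {y : (Fin m' → ℕ) × (Fin n' → ℕ)}
    (hx : IsUnitBlock x) (h : BlockIso x y) : IsUnitBlock y := by
  obtain ⟨a, ha, h1⟩ := hx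
  obtain ⟨e, he⟩ := h
  exact ⟨e a, fun b => e.symm_apply_eq.1 (ha _), (he a a).trans h1⟩

/-- With all row weight at `k`, every position `(k, l)` admits an up-step, so the weight lies above
zero, whose block is `(1)`. -/
theorem isUnitBlock_of_single {x : (Fin m → ℕ) × (Fin n → ℕ)} (k : Fin m) {d : ℕ}
    (h : x.1 = Pi.single k d) (hd : ∑ j, x.2 j = d) : IsUnitBlock x := by
  induction d generalizing x with
  | zero =>
    have h2 : ∀ j, x.2 j = 0 := fun j => (Finset.sum_eq_zero_iff.1 hd) j (Finset.mem_univ j)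
    have h1 : ∀ i, x.1 i = 0 := fun i => by simp [h]
    refine ⟨⟨0, by simp [h1, h2]⟩, fun b => Subtype.ext ?_, entry_zero⟩
    ext ⟨i, j⟩
    have := b.2.1 i
    rw [h1, Finset.sum_eq_zero_iff] at this
    exact this j (Finset.mem_univ j)
  | succ d ih =>
    obtain ⟨l, hl⟩ : ∃ l, x.2 l ≠ 0 := by
      by_contra h0
      push Not at h0
      simp [h0] at hd
    have s2 := sub_single_add x.2 hl
    have t2 : ∑ j, (x.2 - Pi.single l 1 : Fin n → ℕ) j + 1 = ∑ j, x.2 j := by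
      rw [← sum_add_single, s2]
    refine (ih (x := (Pi.single k d, x.2 - Pi.single l 1)) rfl (by dsimp only; omega)).of_iso
      (blockIso_of_covers ⟨k, l, ?_, Prod.ext ?_ s2.symm⟩)
    · simp [Pi.single_apply]
    · rw [h, ← Pi.single_add]

/-! ### Weights above a reduced pair -/

/-- `w` arises from a pair of degree `d` above `a` by insertion of zeros. -/
def Above (a : (Fin r → ℕ) × (Fin s → ℕ)) (d : ℕ) (w : (Fin m → ℕ) × (Fin n → ℕ)) : Prop :=
  ∃ (f : Fin r ↪o Fin m) (g : Fin s ↪o Fin n), ∃ y ∈ aboveSet a d, extendPair f g y = w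

theorem Above.blockIso {a : (Fin r → ℕ) × (Fin s → ℕ)} {d : ℕ} {w : (Fin m → ℕ) × (Fin n → ℕ)}
    (h : Above a d w) : BlockIso a w := by
  obtain ⟨f, g, y, hy, rfl⟩ := h
  exact (blockIso_of_reflTransGen hy.2.2).trans (blockIso_extendPair f g y)

theorem sum_extend (f : Fin r ↪o Fin m) (u : Fin r → ℕ) :
    ∑ i, Function.extend f u 0 i = ∑ i, u i :=
  (Fintype.sum_of_injective f f.injective _ _
    (fun i hi => Function.extend_apply' (f := f) u 0 i hi)
    fun i => (f.injective.extend_apply u 0 i).symm).symm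

theorem Above.sum_eq {a : (Fin r → ℕ) × (Fin s → ℕ)} {d : ℕ} {w : (Fin m → ℕ) × (Fin n → ℕ)}
    (h : Above a d w) : ∑ i, w.1 i = d ∧ ∑ j, w.2 j = d := by
  obtain ⟨f, g, y, hy, rfl⟩ := h
  exact ⟨(sum_extend f y.1).trans hy.1.1, (sum_extend g y.2).trans hy.1.2⟩

theorem range_eq_support (f : Fin r ↪o Fin m) {u : Fin r → ℕ} (hu : ∀ i, u i ≠ 0) :
    Set.range f = {i | Function.extend f u 0 i ≠ 0} := by
  ext i
  by_cases hi : ∃ i', f i' = i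
  · obtain ⟨i, rfl⟩ := hi
    simp [f.injective.extend_apply, hu]
  · simp only [Set.mem_range, hi, false_iff, Set.mem_ofPred_eq, not_not]
    exact Function.extend_apply' _ _ _ hi

/-- The support of the extended vector is the range of the embedding, and an order embedding of `Fin
r` is determined by its range. -/
theorem eq_of_extend_eq {f f' : Fin r ↪o Fin m} {u u' : Fin r → ℕ} (hu : ∀ i, u i ≠ 0)
    (hu' : ∀ i, u' i ≠ 0) (h : Function.extend f u 0 = Function.extend f' u' 0) :
    f = f' ∧ u = u' := by
  have hf : f = f' := by
    rw [← OrderEmbedding.range_inj, range_eq_support f hu, range_eq_support f' hu', h]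
  subst hf
  exact ⟨rfl, Function.extend_injective f.injective 0 h⟩

theorem length_eq_of_extend_eq {r' : ℕ} {f : Fin r ↪o Fin m} {f' : Fin r' ↪o Fin m}
    {u : Fin r → ℕ} {u' : Fin r' → ℕ} (hu : ∀ i, u i ≠ 0)
    (hu' : ∀ i, u' i ≠ 0) (h : Function.extend f u 0 = Function.extend f' u' 0) : r = r' := by
  have h1 : Set.range f = Set.range f' := by
    rw [range_eq_support f hu, range_eq_support f' hu', h]
  have h2 := congrArg Set.ncard h1
  rwa [← Set.image_univ, ← Set.image_univ, Set.ncard_image_of_injective _ f.injective,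
    Set.ncard_image_of_injective _ f'.injective, Set.ncard_univ, Set.ncard_univ,
    Nat.card_fin, Nat.card_fin] at h2

/-- The conditions on a reduced pair that do not depend on the order of its components. -/
structure IsRoot (a : (Fin r → ℕ) × (Fin s → ℕ)) : Prop where
  positive : IsPositive a
  balanced : IsBalanced a
  reduced : IsReduced a
  sum_ne_zero : ∑ i, a.1 i ≠ 0

theorem IsRoot.swap {a : (Fin r → ℕ) × (Fin s → ℕ)} (h : IsRoot a) : IsRoot a.swap :=
  ⟨h.positive.swap, h.balanced.swap, h.reduced.swap h.balanced, by
    rw [Prod.fst_swap, ← h.balanced]; exact h.sum_ne_zero⟩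

/-- A single entry equals the whole degree, so adding any nonzero entry of the other vector violates
reducedness. Hence weights in a class are never lines. -/
theorem IsRoot.two_le {a : (Fin r → ℕ) × (Fin s → ℕ)} (h : IsRoot a) : 2 ≤ r := by
  by_contra hr
  obtain rfl | rfl : r = 0 ∨ r = 1 := by omega
  · exact h.sum_ne_zero (by simp)
  · have h1 := h.sum_ne_zero
    have h2 : ∑ i, a.1 i = ∑ j, a.2 j := h.balanced
    rw [h2] at h1
    obtain ⟨l, -, hl⟩ := Finset.exists_ne_zero_of_sum_ne_zero h1
    have h3 := h.reduced 0 l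
    rw [Fin.sum_univ_one] at h3
    omega

theorem Above.unique {r' s' : ℕ} {a : (Fin r → ℕ) × (Fin s → ℕ)}
    {a' : (Fin r' → ℕ) × (Fin s' → ℕ)} {d : ℕ} {w : (Fin m → ℕ) × (Fin n → ℕ)}
    (ha : IsRoot a) (ha' : IsRoot a') (h : Above a d w) (h' : Above a' d w) :
    List.ofFn a.1 = List.ofFn a'.1 ∧ List.ofFn a.2 = List.ofFn a'.2 := by
  obtain ⟨f, g, y, hy, rfl⟩ := h
  obtain ⟨f', g', y', hy', heq⟩ := h'
  have h1 := congrArg Prod.fst heq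
  have h2 := congrArg Prod.snd heq
  obtain rfl := length_eq_of_extend_eq hy'.2.1.1 hy.2.1.1 h1
  obtain rfl := length_eq_of_extend_eq hy'.2.1.2 hy.2.1.2 h2
  have e1 := (eq_of_extend_eq hy'.2.1.1 hy.2.1.1 h1).2
  have e2 := (eq_of_extend_eq hy'.2.1.2 hy.2.1.2 h2).2
  have e : y' = y := Prod.ext e1 e2
  subst e
  rw [reduced_unique ha.reduced ha.positive ha.balanced ha'.reduced ha'.positive ha'.balanced
    hy.2.2 hy'.2.2]
  exact ⟨rfl, rfl⟩

theorem card_orderEmbedding (r m : ℕ) : Nat.card (Fin r ↪o Fin m) = m.choose r := by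
  have h : Nat.card {t : Finset (Fin m) // t.card = r} = m.choose r := by
    rw [Nat.card_eq_fintype_card, Fintype.card_finset_len, Fintype.card_fin]
  rw [← h]
  refine Nat.card_congr (Equiv.ofBijective
    (fun f => ⟨Finset.univ.map f.toEmbedding, by simp⟩) ⟨fun f f' hff => ?_, fun t => ?_⟩)
  · have h1 := congrArg (fun t : Finset (Fin m) => (t : Set (Fin m))) (congrArg Subtype.val hff)
    rw [← OrderEmbedding.range_inj]
    simpa using h1
  · refine ⟨t.1.orderEmbOfFin t.2, Subtype.ext ?_⟩
    exact Finset.map_orderEmbOfFin_univ t.1 t.2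

theorem ncard_above (a : (Fin r → ℕ) × (Fin s → ℕ)) (d : ℕ) :
    {w : (Fin m → ℕ) × (Fin n → ℕ) | Above a d w}.ncard =
      (aboveSet a d).ncard * (m.choose r * n.choose s) := by
  rw [← Nat.card_coe_set_eq, ← Nat.card_coe_set_eq, ← card_orderEmbedding, ← card_orderEmbedding,
    ← Nat.card_prod, ← Nat.card_prod]
  symm
  refine Nat.card_congr (Equiv.ofBijective
    (fun z => ⟨extendPair z.2.1 z.2.2 z.1.1, z.2.1, z.2.2, z.1.1, z.1.2, rfl⟩) ⟨?_, ?_⟩)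
  · rintro ⟨⟨y, hy⟩, f, g⟩ ⟨⟨y', hy'⟩, f', g'⟩ h
    have h0 := congrArg Subtype.val h
    obtain ⟨rfl, e1⟩ := eq_of_extend_eq hy.2.1.1 hy'.2.1.1 (congrArg Prod.fst h0)
    obtain ⟨rfl, e2⟩ := eq_of_extend_eq hy.2.1.2 hy'.2.1.2 (congrArg Prod.snd h0)
    obtain rfl : y = y' := Prod.ext e1 e2
    rfl
  · rintro ⟨w, f, g, y, hy, rfl⟩
    exact ⟨⟨⟨y, hy⟩, f, g⟩, rfl⟩

/-! ### Lists -/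

/-- The pair of vectors with the entries of two lists. -/
abbrev pairOfLists (σ π : List ℕ) : (Fin σ.length → ℕ) × (Fin π.length → ℕ) := (σ.get, π.get)

theorem sum_get (σ : List ℕ) : ∑ i, σ.get i = σ.sum := by
  rw [← List.sum_ofFn, List.ofFn_get]

theorem IsReducedPair.isRoot {σ π : List ℕ} (h : IsReducedPair σ π) :
    IsRoot (pairOfLists σ π) := by
  refine ⟨⟨fun i => h.entries_ne_zero.1 _ (List.get_mem _ _),
    fun j => h.entries_ne_zero.2 _ (List.get_mem _ _)⟩, ?_, fun k l => ?_, ?_⟩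
  · rw [IsBalanced, sum_get, sum_get, h.sum_eq]
  · rw [sum_get]
    exact h.reduced _ (List.get_mem _ _) _ (List.get_mem _ _)
  · rw [sum_get]
    exact h.nonzero

theorem countReducingTo_eq (σ π : List ℕ) (d : ℕ) :
    countReducingTo σ π d = (aboveSet (pairOfLists σ π) d).ncard := rfl

theorem growthPotential_eq (σ π : List ℕ) :
    growthPotential σ π = growth (pairOfLists σ π) := by
  rw [growthPotential, growth, sum_get]

theorem above_ofFn {a : (Fin r → ℕ) × (Fin s → ℕ)} {d : ℕ} {w : (Fin m → ℕ) × (Fin n → ℕ)}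
    (h : Above a d w) : Above (pairOfLists (List.ofFn a.1) (List.ofFn a.2)) d w := by
  have key : ∀ {r s : ℕ} (a : (Fin r → ℕ) × (Fin s → ℕ)) (σ π : List ℕ) (hσ : σ.length = r)
      (hπ : π.length = s), (∀ i, a.1 i = σ.get (i.cast hσ.symm)) →
      (∀ j, a.2 j = π.get (j.cast hπ.symm)) → Above a d w → Above (pairOfLists σ π) d w := by
    intro r s a σ π hσ hπ h1 h2 h
    subst hσ
    subst hπ
    have : a = pairOfLists σ π := Prod.ext (funext h1) (funext h2)
    rwa [← this]
  exact key a _ _ (by simp) (by simp) (fun i => by simp) (fun j => by simp) h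

theorem isReducedPair_ofFn {a : (Fin r → ℕ) × (Fin s → ℕ)} (ha : IsRoot a) (hle : r ≤ s)
    (hlex : r = s → List.ofFn a.2 ≤ List.ofFn a.1) :
    IsReducedPair (List.ofFn a.1) (List.ofFn a.2) := by
  refine ⟨⟨fun b hb => ?_, fun b hb => ?_⟩, by simpa using hle, by simpa using hlex, ?_, ?_, ?_⟩
  · obtain ⟨i, rfl⟩ := (List.mem_ofFn' _ _).1 hb
    exact ha.positive.1 i
  · obtain ⟨i, rfl⟩ := (List.mem_ofFn' _ _).1 hb
    exact ha.positive.2 i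
  · rw [List.sum_ofFn, List.sum_ofFn]
    exact ha.balanced
  · rw [List.sum_ofFn]
    exact ha.sum_ne_zero
  · intro b hb c hc
    obtain ⟨i, rfl⟩ := (List.mem_ofFn' _ _).1 hb
    obtain ⟨j, rfl⟩ := (List.mem_ofFn' _ _).1 hc
    rw [List.sum_ofFn]
    exact ha.reduced i j

/-- The weights whose block is a copy of the block of `(σ, π)`. -/
def InClass (σ π : List ℕ) (d : ℕ) (w : (Fin m → ℕ) × (Fin n → ℕ)) : Prop :=
  Above (pairOfLists σ π) d w ∨ Above (pairOfLists π σ) d w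

theorem InClass.blockIso {σ π : List ℕ} {d : ℕ} {w : (Fin m → ℕ) × (Fin n → ℕ)}
    (h : InClass σ π d w) : BlockIso (pairOfLists σ π) w := by
  rcases h with h | h
  · exact h.blockIso
  · exact (blockIso_swap (pairOfLists σ π)).trans h.blockIso

theorem InClass.sum_eq {σ π : List ℕ} {d : ℕ} {w : (Fin m → ℕ) × (Fin n → ℕ)}
    (h : InClass σ π d w) : ∑ i, w.1 i = d ∧ ∑ j, w.2 j = d := by
  rcases h with h | h
  · exact h.sum_eq
  · exact h.sum_eq

theorem Above.list_unique {σ π σ' π' : List ℕ} {d : ℕ} {w : (Fin m → ℕ) × (Fin n → ℕ)}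
    (hr : IsRoot (pairOfLists σ π)) (hr' : IsRoot (pairOfLists σ' π'))
    (h : Above (pairOfLists σ π) d w) (h' : Above (pairOfLists σ' π') d w) : σ = σ' ∧ π = π' := by
  have := Above.unique hr hr' h h'
  simpa [pairOfLists, List.ofFn_get] using this

theorem IsReducedPair.eq_of_swap {σ π : List ℕ} (h : IsReducedPair σ π)
    (h' : IsReducedPair π σ) : σ = π := by
  have hl := le_antisymm h.length_le h'.length_le
  exact le_antisymm (h'.lex hl.symm) (h.lex hl)

theorem InClass.unique {σ π σ' π' : List ℕ} {d : ℕ} {w : (Fin m → ℕ) × (Fin n → ℕ)}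
    (hr : IsReducedPair σ π) (hr' : IsReducedPair σ' π') (h : InClass σ π d w)
    (h' : InClass σ' π' d w) : σ = σ' ∧ π = π' := by
  rcases h with h | h <;> rcases h' with h' | h'
  · exact h.list_unique hr.isRoot hr'.isRoot h'
  · obtain ⟨rfl, rfl⟩ := h.list_unique hr.isRoot hr'.isRoot.swap h'
    have := hr.eq_of_swap hr'
    exact ⟨this, this.symm⟩
  · obtain ⟨rfl, rfl⟩ := h.list_unique hr.isRoot.swap hr'.isRoot h'
    have := hr.eq_of_swap hr'
    exact ⟨this, this.symm⟩
  · exact (h.list_unique hr.isRoot.swap hr'.isRoot.swap h').symm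

theorem finite_setOf_sum_eq (m n d : ℕ) :
    {w : (Fin m → ℕ) × (Fin n → ℕ) | ∑ i, w.1 i = d ∧ ∑ j, w.2 j = d}.Finite := by
  refine (((Finset.univ.piAntidiag d) ×ˢ (Finset.univ.piAntidiag d) :
    Finset ((Fin m → ℕ) × (Fin n → ℕ))).finite_toSet).subset fun w hw => ?_
  simpa using hw

/-- For `σ ≠ π` the weights above the pair and above its swap are disjoint, which gives the two
products of binomials; for `σ = π` the two sets coincide. -/
theorem ncard_inClass {σ π : List ℕ} (h : IsReducedPair σ π) (d : ℕ) :
    {w : (Fin m → ℕ) × (Fin n → ℕ) | InClass σ π d w}.ncard = blockMult m n d σ π := by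
  rw [blockMult, countReducingTo_eq]
  split_ifs with heq
  · subst heq
    simp only [InClass, or_self]
    exact ncard_above _ _
  · have hunion : {w : (Fin m → ℕ) × (Fin n → ℕ) | InClass σ π d w} =
        {w | Above (pairOfLists σ π) d w} ∪ {w | Above (pairOfLists π σ) d w} := rfl
    have hfin := finite_setOf_sum_eq m n d
    have h1 : {w : (Fin m → ℕ) × (Fin n → ℕ) | Above (pairOfLists σ π) d w}.Finite :=
      hfin.subset fun w hw => Above.sum_eq hw
    have h2 : {w : (Fin m → ℕ) × (Fin n → ℕ) | Above (pairOfLists π σ) d w}.Finite :=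
      hfin.subset fun w hw => Above.sum_eq hw
    rw [hunion, Set.ncard_union_eq ?_ h1 h2, ncard_above, ncard_above]
    · have := ncard_aboveSet_swap (pairOfLists σ π) d h.isRoot.positive h.isRoot.balanced
      rw [Prod.swap_prod_mk] at this
      rw [this]
      ring
    · rw [Set.disjoint_left]
      intro w h1 h2
      exact heq (Above.list_unique h.isRoot h.isRoot.swap h1 h2).1

/-! ### Weights with one row or one column -/

/-- The weights for which one of the two vectors has a single nonzero entry. -/
def IsLine (d : ℕ) (w : (Fin m → ℕ) × (Fin n → ℕ)) : Prop :=
  ((∃ k, w.1 = Pi.single k d) ∧ ∑ j, w.2 j = d) ∨ ((∃ l, w.2 = Pi.single l d) ∧ ∑ i, w.1 i = d)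

theorem IsLine.isUnitBlock {d : ℕ} {w : (Fin m → ℕ) × (Fin n → ℕ)} (h : IsLine d w) :
    IsUnitBlock w := by
  rcases h with ⟨⟨k, hk⟩, h⟩ | ⟨⟨l, hl⟩, h⟩
  · exact isUnitBlock_of_single k hk h
  · exact (isUnitBlock_of_single (x := w.swap) l hl h).of_iso (blockIso_swap w.swap)

theorem IsLine.sum_eq {d : ℕ} {w : (Fin m → ℕ) × (Fin n → ℕ)} (h : IsLine d w) :
    ∑ i, w.1 i = d ∧ ∑ j, w.2 j = d := by
  rcases h with ⟨⟨k, hk⟩, h⟩ | ⟨⟨l, hl⟩, h⟩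
  · exact ⟨by simp [hk], h⟩
  · exact ⟨h, by simp [hl]⟩

theorem single_left_injective {d : ℕ} (hd : d ≠ 0) {k k' : Fin m}
    (h : (Pi.single k d : Fin m → ℕ) = Pi.single k' d) : k = k' := by
  by_contra hne
  have := congrFun h k
  rw [Pi.single_eq_same, Pi.single_eq_of_ne hne] at this
  exact hd this

theorem ncard_single_left (m n : ℕ) {d : ℕ} (hd : d ≠ 0) :
    {w : (Fin m → ℕ) × (Fin n → ℕ) | (∃ k, w.1 = Pi.single k d) ∧ ∑ j, w.2 j = d}.ncard =
      (d + n - 1).choose d * m := by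
  have himage : {w : (Fin m → ℕ) × (Fin n → ℕ) | (∃ k, w.1 = Pi.single k d) ∧ ∑ j, w.2 j = d} =
      (fun z : Fin m × (Fin n → ℕ) => ((Pi.single z.1 d : Fin m → ℕ), z.2)) ''
        ((Finset.univ ×ˢ Finset.univ.piAntidiag d : Finset (Fin m × (Fin n → ℕ))) : Set _) := by
    ext w
    simp only [Set.mem_ofPred_eq, Set.mem_image, Finset.mem_coe, Finset.mem_product,
      Finset.mem_univ, true_and, Finset.mem_piAntidiag]
    constructor
    · rintro ⟨⟨k, hk⟩, h⟩
      exact ⟨(k, w.2), ⟨h, by simp⟩, Prod.ext hk.symm rfl⟩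
    · rintro ⟨z, ⟨h, -⟩, rfl⟩
      exact ⟨⟨z.1, rfl⟩, h⟩
  rw [himage, Set.ncard_image_of_injective, Set.ncard_coe_finset, Finset.card_product,
    card_piAntidiag, Finset.card_univ, Finset.card_univ, Fintype.card_fin, Fintype.card_fin,
    add_comm n d, mul_comm]
  rintro ⟨k, c⟩ ⟨k', c'⟩ h
  rw [Prod.mk.injEq] at h
  exact Prod.ext (single_left_injective hd h.1) h.2

/-- Inclusion–exclusion; the `m * n` weights concentrated in both vectors are counted twice. -/
theorem ncard_isLine (m n : ℕ) {d : ℕ} (hd : d ≠ 0) :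
    {w : (Fin m → ℕ) × (Fin n → ℕ) | IsLine d w}.ncard = trivialMult m n d := by
  have hA := ncard_single_left m n hd
  have hB : {w : (Fin m → ℕ) × (Fin n → ℕ) |
      (∃ l, w.2 = Pi.single l d) ∧ ∑ i, w.1 i = d}.ncard = (d + m - 1).choose d * n := by
    rw [← ncard_single_left n m hd, ← Set.ncard_image_of_injective
      {w : (Fin n → ℕ) × (Fin m → ℕ) | (∃ l, w.1 = Pi.single l d) ∧ ∑ i, w.2 i = d}
      Prod.swap_injective]
    congr 1
    ext w
    rw [Set.mem_image]
    constructor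
    · intro h
      exact ⟨w.swap, h, by simp⟩
    · rintro ⟨z, h, rfl⟩
      exact h
  have hAB : ({w : (Fin m → ℕ) × (Fin n → ℕ) | (∃ k, w.1 = Pi.single k d) ∧ ∑ j, w.2 j = d} ∩
      {w | (∃ l, w.2 = Pi.single l d) ∧ ∑ i, w.1 i = d}).ncard = m * n := by
    have himage : ({w : (Fin m → ℕ) × (Fin n → ℕ) | (∃ k, w.1 = Pi.single k d) ∧ ∑ j, w.2 j = d} ∩
        {w | (∃ l, w.2 = Pi.single l d) ∧ ∑ i, w.1 i = d}) =
        (fun z : Fin m × Fin n => ((Pi.single z.1 d : Fin m → ℕ), (Pi.single z.2 d : Fin n → ℕ))) ''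
          Set.univ := by
      ext w
      simp only [Set.mem_inter_iff, Set.mem_ofPred_eq, Set.mem_image, Set.mem_univ, true_and]
      constructor
      · rintro ⟨⟨⟨k, hk⟩, -⟩, ⟨l, hl⟩, -⟩
        exact ⟨(k, l), Prod.ext hk.symm hl.symm⟩
      · rintro ⟨z, rfl⟩
        exact ⟨⟨⟨_, rfl⟩, by simp⟩, ⟨_, rfl⟩, by simp⟩
    rw [himage, Set.ncard_image_of_injective, Set.ncard_univ, Nat.card_prod, Nat.card_fin,
      Nat.card_fin]
    rintro ⟨k, l⟩ ⟨k', l'⟩ h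
    rw [Prod.mk.injEq] at h
    exact Prod.ext (single_left_injective hd h.1) (single_left_injective hd h.2)
  have hfin := finite_setOf_sum_eq m n d
  have hU := Set.ncard_union_add_ncard_inter
    {w : (Fin m → ℕ) × (Fin n → ℕ) | (∃ k, w.1 = Pi.single k d) ∧ ∑ j, w.2 j = d}
    {w | (∃ l, w.2 = Pi.single l d) ∧ ∑ i, w.1 i = d}
    (hfin.subset fun w hw => IsLine.sum_eq (Or.inl hw))
    (hfin.subset fun w hw => IsLine.sum_eq (Or.inr hw))
  rw [hA, hB, hAB] at hU
  rw [trivialMult, ← hU, Nat.add_sub_cancel]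
  rfl

theorem not_single_of_extend {f : Fin r ↪o Fin m} {u : Fin r → ℕ} (hu : ∀ i, u i ≠ 0)
    (hr : 2 ≤ r) {k : Fin m} {d : ℕ} (h : Function.extend f u 0 = Pi.single k d) : False := by
  have key : ∀ i, f i = k := fun i => by
    by_contra hi
    have := congrFun h (f i)
    rw [f.injective.extend_apply, Pi.single_eq_of_ne hi] at this
    exact hu i this
  have := f.injective ((key ⟨0, by omega⟩).trans (key ⟨1, by omega⟩).symm)
  simp at this

theorem Above.not_isLine {a : (Fin r → ℕ) × (Fin s → ℕ)} {d : ℕ} {w : (Fin m → ℕ) × (Fin n → ℕ)}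
    (ha : IsRoot a) (h : Above a d w) : ¬ IsLine d w := by
  obtain ⟨f, g, y, hy, rfl⟩ := h
  rintro (⟨⟨k, hk⟩, -⟩ | ⟨⟨l, hl⟩, -⟩)
  · exact not_single_of_extend hy.2.1.1 ha.two_le hk
  · exact not_single_of_extend hy.2.1.2 ha.swap.two_le hl

theorem InClass.not_isLine {σ π : List ℕ} {d : ℕ} {w : (Fin m → ℕ) × (Fin n → ℕ)}
    (hr : IsReducedPair σ π) (h : InClass σ π d w) : ¬ IsLine d w := by
  rcases h with h | h
  · exact h.not_isLine hr.isRoot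
  · exact h.not_isLine hr.isRoot.swap

theorem exists_extend_eq (u : Fin m → ℕ) {d : ℕ} (hd : d ≠ 0) (hu : ∑ i, u i = d)
    (hne : ¬ ∃ k, u = Pi.single k d) :
    ∃ (r : ℕ) (f : Fin r ↪o Fin m) (v : Fin r → ℕ), 2 ≤ r ∧ (∀ i, v i ≠ 0) ∧
      Function.extend f v 0 = u := by
  set S := Finset.univ.filter fun i => u i ≠ 0 with hS
  have hmem : ∀ i, i ∈ S ↔ u i ≠ 0 := fun i => by simp [hS]
  set f := S.orderEmbOfFin rfl with hf
  have hext : Function.extend f (u ∘ f) 0 = u := by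
    ext i
    by_cases hi : ∃ i', f i' = i
    · obtain ⟨i, rfl⟩ := hi
      rw [f.injective.extend_apply, Function.comp_apply]
    · rw [Function.extend_apply' _ _ _ hi, Pi.zero_apply]
      by_contra h0
      have : i ∈ Set.range f := by
        rw [hf, Finset.range_orderEmbOfFin]
        exact (hmem i).2 (Ne.symm h0)
      exact hi this
  refine ⟨S.card, f, u ∘ f, ?_, fun i => (hmem _).1 (S.orderEmbOfFin_mem rfl i), hext⟩
  by_contra hlt
  have hcard : S.card ≤ 1 := by omega
  obtain ⟨k, hk⟩ : ∃ k, u k ≠ 0 := by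
    by_contra h0
    push Not at h0
    exact hd (by rw [← hu]; simp [h0])
  have hzero : ∀ i, i ≠ k → u i = 0 := by
    intro i hi
    by_contra h0
    exact hi (Finset.card_le_one.1 hcard i ((hmem i).2 h0) k ((hmem k).2 hk))
  refine hne ⟨k, ?_⟩
  have huk : u k = d := by
    rw [← hu]
    exact (Finset.sum_eq_single k (fun i _ hi => hzero i hi) (by simp)).symm
  ext i
  by_cases hi : i = k
  · rw [hi, Pi.single_eq_same, huk]
  · rw [Pi.single_eq_of_ne hi, hzero i hi]

theorem exists_inClass {d : ℕ} (hd : d ≠ 0) {w : (Fin m → ℕ) × (Fin n → ℕ)}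
    (h1 : ∑ i, w.1 i = d) (h2 : ∑ j, w.2 j = d) (hw : ¬ IsLine d w) :
    ∃ x : ReducedPair d, InClass x.1.1 x.1.2 d w := by
  obtain ⟨r, f, u, hr, hu, hfu⟩ := exists_extend_eq w.1 hd h1 fun h => hw (Or.inl ⟨h, h2⟩)
  obtain ⟨s, g, v, hs, hv, hgv⟩ := exists_extend_eq w.2 hd h2 fun h => hw (Or.inr ⟨h, h1⟩)
  have su : ∑ i, u i = d := by rw [← sum_extend f u, hfu, h1]
  have sv : ∑ i, v i = d := by rw [← sum_extend g v, hgv, h2]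
  obtain ⟨a, ha1, ha2, ha3, ha4⟩ := exists_reduced (w := (u, v)) hr hs ⟨hu, hv⟩ (su.trans sv.symm)
  have hroot : IsRoot a := by
    refine ⟨ha2, ha3, ha1, fun h0 => ?_⟩
    have := le_sum a.1 ⟨0, by omega⟩
    exact ha2.1 ⟨0, by omega⟩ (by omega)
  have hab : Above a d w :=
    ⟨f, g, (u, v), ⟨⟨su, sv⟩, ⟨hu, hv⟩, ha4⟩, Prod.ext hfu hgv⟩
  have hle : ∑ i, a.1 i ≤ d := su ▸ sum_le_of_reflTransGen ha4
  have hab' := above_ofFn hab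
  have first : r ≤ s → (r = s → List.ofFn a.2 ≤ List.ofFn a.1) →
      ∃ x : ReducedPair d, InClass x.1.1 x.1.2 d w := fun h h' =>
    ⟨⟨(List.ofFn a.1, List.ofFn a.2), isReducedPair_ofFn hroot h h', by
      rw [List.sum_ofFn]; exact hle⟩, Or.inl hab'⟩
  have second : s ≤ r → (s = r → List.ofFn a.1 ≤ List.ofFn a.2) →
      ∃ x : ReducedPair d, InClass x.1.1 x.1.2 d w := fun h h' =>
    ⟨⟨(List.ofFn a.2, List.ofFn a.1), isReducedPair_ofFn hroot.swap h h', by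
      rw [List.sum_ofFn, ← show ∑ i, a.1 i = ∑ j, a.2 j from ha3]; exact hle⟩, Or.inr hab'⟩
  rcases lt_trichotomy r s with h | h | h
  · exact first h.le fun h' => absurd h' h.ne
  -- For equal lengths the lexicographic order decides which vector comes first.
  · rcases le_total (List.ofFn a.2) (List.ofFn a.1) with h' | h'
    · exact first h.le fun _ => h'
    · exact second h.ge fun _ => h'
  · exact second h.le fun h' => absurd h' h.ne

end BlockRSK

/-! ### Assembly of the direct sum -/

namespace BlockRSK

/-! ### Assembling the blocks -/

/-- A matrix that vanishes off the fibres of a map `wt` is a direct sum of its restrictions to the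
fibres. Here the fibres over the values of `t` give identity blocks of size one, and the fibre over
`c ⟨x, i⟩` gives a copy of the matrix `B x`. -/
theorem exists_block_equiv {E W X T : Type} {K F : X → Type} [DecidableEq X] [DecidableEq T]
    [∀ x, DecidableEq (F x)] (M : Matrix E E ℂ) (wt : E → W)
    (hM : ∀ β α, wt β ≠ wt α → M β α = 0)
    (t : T → W) (ht : Function.Injective t)
    (htM : ∀ i, ∃ a, wt a = t i ∧ (∀ b, wt b = t i → b = a) ∧ M a a = 1)
    (c : (Σ x, F x) → W) (hc : Function.Injective c) (B : ∀ x, Matrix (K x) (K x) ℂ)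
    (hcB : ∀ p : Σ x, F x, ∃ e : K p.1 → E, Function.Injective e ∧
      (∀ b, wt b = c p ↔ ∃ k, e k = b) ∧ ∀ k k', M (e k) (e k') = B p.1 k k')
    (hcover : ∀ α, (∃ i, t i = wt α) ∨ ∃ p, c p = wt α) (hdisj : ∀ i p, t i ≠ c p) :
    ∃ e : E ≃ T ⊕ (Σ x, K x × F x), Matrix.reindex e e M =
      Matrix.fromBlocks 1 0 0
        (Matrix.blockDiagonal' fun x => Matrix.blockDiagonal fun _ : F x => B x) := by
  choose a ha ha' ha1 using htM
  choose f hf hf' hfB using hcB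
  have hwf : ∀ p k, wt (f p k) = c p := fun p k => (hf' p _).2 ⟨k, rfl⟩
  let ψ : T ⊕ (Σ x, K x × F x) → E := Sum.elim a fun z => f ⟨z.1, z.2.2⟩ z.2.1
  have hψ : Function.Bijective ψ := by
    constructor
    · rintro (i | ⟨x, k, i⟩) (j | ⟨y, l, j⟩) h
      · have h1 := congrArg wt h
        simp only [ψ, Sum.elim_inl, ha] at h1
        rw [ht h1]
      · have h1 := congrArg wt h
        simp only [ψ, Sum.elim_inl, Sum.elim_inr, ha, hwf] at h1
        exact absurd h1 (hdisj _ _)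
      · have h1 := congrArg wt h
        simp only [ψ, Sum.elim_inl, Sum.elim_inr, ha, hwf] at h1
        exact absurd h1.symm (hdisj _ _)
      · have h1 := congrArg wt h
        simp only [ψ, Sum.elim_inr, hwf] at h1
        have h2 := hc h1
        cases h2
        have h3 : k = l := hf _ h
        rw [h3]
    · intro α
      rcases hcover α with ⟨i, hi⟩ | ⟨p, hp⟩
      · exact ⟨Sum.inl i, (ha' i α hi.symm).symm⟩
      · obtain ⟨k, hk⟩ := (hf' p α).1 hp.symm
        exact ⟨Sum.inr ⟨p.1, k, p.2⟩, hk⟩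
  refine ⟨(Equiv.ofBijective ψ hψ).symm, ?_⟩
  ext u v
  rw [Matrix.reindex_apply, Matrix.submatrix_apply, Equiv.symm_symm, Equiv.ofBijective_apply,
    Equiv.ofBijective_apply]
  rcases u with i | ⟨x, k, i⟩ <;> rcases v with j | ⟨y, l, j⟩
  · rw [Matrix.fromBlocks_apply₁₁]
    by_cases hij : i = j
    · subst hij
      rw [Matrix.one_apply_eq]
      exact ha1 i
    · rw [Matrix.one_apply_ne hij]
      refine hM _ _ ?_
      simpa only [ψ, Sum.elim_inl, ha] using ht.ne hij
  · rw [Matrix.fromBlocks_apply₁₂, Matrix.zero_apply]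
    refine hM _ _ ?_
    simpa only [ψ, Sum.elim_inl, Sum.elim_inr, ha, hwf] using hdisj _ _
  · rw [Matrix.fromBlocks_apply₂₁, Matrix.zero_apply]
    refine hM _ _ ?_
    simpa only [ψ, Sum.elim_inl, Sum.elim_inr, ha, hwf] using (hdisj _ _).symm
  · rw [Matrix.fromBlocks_apply₂₂]
    by_cases hxy : x = y
    · subst hxy
      rw [Matrix.blockDiagonal'_apply_eq, Matrix.blockDiagonal_apply]
      by_cases hij : i = j
      · subst hij
        rw [if_pos rfl]
        exact hfB ⟨x, i⟩ k l
      · rw [if_neg hij]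
        refine hM _ _ ?_
        simp only [ψ, Sum.elim_inr, hwf]
        refine hc.ne fun h => hij ?_
        simpa using h
    · rw [Matrix.blockDiagonal'_apply_ne _ _ _ hxy]
      refine hM _ _ ?_
      simp only [ψ, Sum.elim_inr, hwf]
      exact hc.ne fun h => hxy (congrArg Sigma.fst h)

variable {m n d : ℕ}

/-- The inclusion of a weight space into the degree-`d` part. -/
def contToExpo {w : (Fin m → ℕ) × (Fin n → ℕ)} (hw : ∑ i, w.1 i = d) (α : Cont w.1 w.2) :
    Expo m n d :=
  ⟨α.1, (sum_eq_of_margins (cont_iff.1 α.2)).trans hw⟩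

theorem nonempty_equiv_fin {W : Type} {S : Set W} {N : ℕ} (hS : S.Finite) (h : S.ncard = N) :
    Nonempty (Fin N ≃ S) := by
  have := hS.to_subtype
  exact ⟨(Finite.equivFinOfCardEq (by rw [Nat.card_coe_set_eq, h])).symm⟩

theorem rskMatrix_apply (β α : Expo m n d) : rskMatrix m n d β α = entry β.1 α.1 := by
  rw [rskMatrix, Matrix.of_apply, rskOperator_monomial]
  rfl

theorem rskWeightMatrix_apply {σ : Fin m → ℕ} {π : Fin n → ℕ} (β α : Cont σ π) :
    rskWeightMatrix σ π β α = entry β.1 α.1 := by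
  rw [rskWeightMatrix, Matrix.of_apply, rskOperator_monomial]
  rfl

/-- Each weight of degree `d` is either a line or in the class of exactly one reduced pair.
Enumerating the lines and each class by its cardinality labels the copies of the blocks. -/
theorem exists_block_decomposition (m n d : ℕ) (hd : 1 ≤ d) :
    ∃ e : Expo m n d ≃ Fin (trivialMult m n d) ⊕
        (Σ x : ReducedPair d, Cont x.1.1.get x.1.2.get × Fin (blockMult m n d x.1.1 x.1.2)),
      Matrix.reindex e e (rskMatrix m n d) =
        Matrix.fromBlocks 1 0 0
          (Matrix.blockDiagonal' fun x : ReducedPair d =>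
            Matrix.blockDiagonal fun _ : Fin (blockMult m n d x.1.1 x.1.2) =>
              rskWeightMatrix x.1.1.get x.1.2.get) := by
  have hd0 : d ≠ 0 := by omega
  have hfin := finite_setOf_sum_eq m n d
  obtain ⟨t⟩ := nonempty_equiv_fin
    (S := {w : (Fin m → ℕ) × (Fin n → ℕ) | IsLine d w})
    (hfin.subset fun w hw => IsLine.sum_eq hw) (ncard_isLine m n hd0)
  have hclass : ∀ x : ReducedPair d, Nonempty (Fin (blockMult m n d x.1.1 x.1.2) ≃
      {w : (Fin m → ℕ) × (Fin n → ℕ) | InClass x.1.1 x.1.2 d w}) := fun x =>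
    nonempty_equiv_fin (hfin.subset fun w hw => InClass.sum_eq hw) (ncard_inClass x.2.1 d)
  let c := fun x => (hclass x).some
  refine exists_block_equiv (rskMatrix m n d) (fun α => margins α.1) ?_
    (fun i => (t i).1) ?_ ?_ (fun p => (c p.1 p.2).1) ?_ _ ?_ ?_ ?_
  · intro β α h
    rw [rskMatrix_apply]
    exact entry_eq_zero h
  · exact Subtype.val_injective.comp t.injective
  · intro i
    have hi : IsLine d (t i).1 := (t i).2
    obtain ⟨a, ha, ha1⟩ := hi.isUnitBlock
    refine ⟨contToExpo hi.sum_eq.1 a, cont_iff.1 a.2, fun b hb => ?_, ?_⟩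
    · exact Subtype.ext (congrArg (fun z => z.1) (ha ⟨b.1, cont_iff.2 hb⟩))
    · rw [rskMatrix_apply]
      exact ha1
  · rintro ⟨x, i⟩ ⟨y, j⟩ h
    have hx : InClass x.1.1 x.1.2 d (c x i).1 := (c x i).2
    have hy : InClass y.1.1 y.1.2 d (c x i).1 := by
      have := (c y j).2
      rwa [← show (c x i).1 = (c y j).1 from h] at this
    obtain ⟨h1, h2⟩ := hx.unique x.2.1 y.2.1 hy
    obtain rfl : x = y := Subtype.ext (Prod.ext h1 h2)
    have hij : i = j := (c x).injective (Subtype.ext h)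
    rw [hij]
  · rintro ⟨x, i⟩
    have hx : InClass x.1.1 x.1.2 d (c x i).1 := (c x i).2
    obtain ⟨e, he⟩ := hx.blockIso
    refine ⟨fun k => contToExpo hx.sum_eq.1 (e k), ?_, fun b => ⟨fun hb => ?_, ?_⟩, fun k k' => ?_⟩
    · intro k k' h
      exact e.injective (Subtype.ext (congrArg (fun z => z.1) h))
    · refine ⟨e.symm ⟨b.1, cont_iff.2 hb⟩, ?_⟩
      dsimp only
      rw [Equiv.apply_symm_apply]
      rfl
    · rintro ⟨k, rfl⟩
      exact cont_iff.1 (e k).2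
    · rw [rskMatrix_apply, rskWeightMatrix_apply]
      exact he k k'
  · intro α
    have h1 : ∑ i, (margins α.1).1 i = d := (sum_eq_of_margins rfl).symm.trans α.2
    have h2 : ∑ j, (margins α.1).2 j = d := by
      refine Eq.trans ?_ α.2
      rw [Fintype.sum_prod_type, Finset.sum_comm]
      rfl
    by_cases hw : IsLine d (margins α.1)
    · exact Or.inl ⟨t.symm ⟨_, hw⟩, by simp⟩
    · obtain ⟨x, hx⟩ := exists_inClass hd0 h1 h2 hw
      exact Or.inr ⟨⟨x, (c x).symm ⟨_, hx⟩⟩, by simp⟩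
  · rintro i ⟨x, j⟩ h
    have hx : InClass x.1.1 x.1.2 d (c x j).1 := (c x j).2
    have hi : IsLine d (t i).1 := (t i).2
    exact hx.not_isLine x.2.1 (h ▸ hi)

theorem countReducingTo_of_three_le {σ π : List ℕ} (h : IsReducedPair σ π) (hd : σ.sum ≤ d)
    (h3 : 3 ≤ π.length) : countReducingTo σ π d =
      if 1 ≤ growthPotential σ π then
        ((d - σ.sum) + (growthPotential σ π - 1)).choose (growthPotential σ π - 1)
      else if d = σ.sum then 1 else 0 := by
  have hr := h.isRoot
  have := ncard_aboveSet (d := d) hr.positive hr.balanced hr.reduced (by rwa [sum_get]) h3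
  rwa [sum_get, ← growthPotential_eq] at this

theorem countReducingTo_of_two {σ π : List ℕ} (h : IsReducedPair σ π) (hd : σ.sum ≤ d)
    (hσ : σ.length = 2) (hπ : π.length = 2) : countReducingTo σ π d =
      4 * (d - σ.sum) + if d = σ.sum then 1 else 0 := by
  have key : ∀ {r s : ℕ} (a : (Fin r → ℕ) × (Fin s → ℕ)), r = 2 → s = 2 → IsRoot a →
      ∑ i, a.1 i ≤ d →
      (aboveSet a d).ncard = 4 * (d - ∑ i, a.1 i) + if d = ∑ i, a.1 i then 1 else 0 := by
    intro r s a hr hs ha hle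
    subst hr
    subst hs
    exact ncard_aboveSet_two ha.positive ha.balanced ha.reduced hle
  have := key (pairOfLists σ π) hσ hπ h.isRoot (by rwa [sum_get])
  rwa [sum_get] at this

end BlockRSK

theorem theorem3p15 (m n d : ℕ) (hd : 1 ≤ d) :
    -- the block decomposition, after a common reordering of rows and columns
    (∃ e : BlockRSK.Expo m n d ≃
        Fin (BlockRSK.trivialMult m n d) ⊕
          (Σ x : BlockRSK.ReducedPair d,
            BlockRSK.Cont x.1.1.get x.1.2.get × Fin (BlockRSK.blockMult m n d x.1.1 x.1.2)),
      Matrix.reindex e e (BlockRSK.rskMatrix m n d) =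
        Matrix.fromBlocks 1 0 0
          (Matrix.blockDiagonal' fun x : BlockRSK.ReducedPair d =>
            Matrix.blockDiagonal fun _ : Fin (BlockRSK.blockMult m n d x.1.1 x.1.2) =>
              BlockRSK.rskWeightMatrix x.1.1.get x.1.2.get)) ∧
    -- the explicit values of the numbers `A_{σ,π}(d)` that enter the multiplicities
    (∀ σ π : List ℕ, BlockRSK.IsReducedPair σ π → σ.sum ≤ d →
      (3 ≤ π.length → BlockRSK.countReducingTo σ π d =
        if 1 ≤ BlockRSK.growthPotential σ π then
          ((d - σ.sum) + (BlockRSK.growthPotential σ π - 1)).choose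
            (BlockRSK.growthPotential σ π - 1)
        else if d = σ.sum then 1 else 0) ∧
      (σ.length = 2 → π.length = 2 → BlockRSK.countReducingTo σ π d =
        4 * (d - σ.sum) + if d = σ.sum then 1 else 0)) :=
  ⟨BlockRSK.exists_block_decomposition m n d hd, fun _ _ h hle =>
    ⟨BlockRSK.countReducingTo_of_three_le h hle, BlockRSK.countReducingTo_of_two h hle⟩⟩
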